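/- Let $K\subset\mathbb R^d$ be compact. For a cost $c:\mathbb R^d\times\mathbb R^d\to[0,\infty)$ and probability measures $\alpha,\beta$ on $\mathbb R^d$ let $\mathrm{OT}_c(\alpha,\beta)=\inf_\gamma\int c\,d\gamma$, the infimum being over all couplings $\gamma$ of $\alpha$ and $\beta$. For $k\ge1$ let $\Delta^k$ be the set of probability measures $\sum_{i=1}^k w_i\delta_{a_i}$ with $w_i\ge 0$, $\sum_i w_i=1$, $a_i\in\mathbb R^d$. Let $c(x,y)=\|x-y\|^2$ be the squared Euclidean distance, let $c_z:\mathbb R^d\times\mathbb R^d\to[0,\infty)$ be any cost between anchors, and let $$\mathrm{OT}^L(\mu,\nu)=\inf_{\mu_z\in\Delta^{k_x},\ \nu_z\in\Delta^{k_y}}\big\{\mathrm{OT}_{c}(\mu,\mu_z)+\mathrm{OT}_{c_z}(\mu_z,\nu_z)+\mathrm{OT}_{c}(\nu_z,\nu)\big\}$$ be the latent optimal transport cost with $k_x$ source anchors and $k_y$ target anchors whose locations in $\mathbb R^d$ are unrestricted. There is a constant $C\ge 0$, depending only on $d$, $K$ and $c_z$, such that the following holds for all probability measures $\mu,\nu$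 supported on $K$, all integers $k_x,k_y,n,m\ge1$ and all $\delta\in(0,1)$. Let $\hat\mu=\frac1n\sum_{i=1}^n\delta_{X_i}$ and $\hat\nu=\frac1m\sum_{j=1}^m\delta_{Y_j}$ be the empirical measures of $n$ i.i.d. samples $X_i$ from $\mu$ and $m$ i.i.d. samples $Y_j$ from $\nu$. Then $\mathrm{OT}^L(\mu,\nu)$ and $\mathrm{OT}^L(\hat\mu,\hat\nu)$ are finite and, with probability at least $1-\delta$, $$\big|\mathrm{OT}^L(\mu,\nu)-\mathrm{OT}^L(\hat\mu,\hat\nu)\big|\le C\sqrt{\frac{k_{\max}^3\,d\,\log k_{\max}+\log(2/\delta)}{N}},\qquad k_{\max}=\max\{k_x,k_y\},\quad N=\min\{n,m\}.$$ -/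

import Mathlib

open MeasureTheory ProbabilityTheory
open scoped ENNReal NNReal

namespace LatentOT

/-- The set of couplings of `μ` and `ν`: measures on the product space whose marginals are
`μ` and `ν`. -/
def couplings {α β : Type*} [MeasurableSpace α] [MeasurableSpace β]
    (μ : Measure α) (ν : Measure β) : Set (Measure (α × β)) :=
  {γ | γ.map Prod.fst = μ ∧ γ.map Prod.snd = ν}

/-- The optimal transport cost between `μ` and `ν` for the nonnegative cost function `c`. -/
noncomputable def otCost {α β : Type*} [MeasurableSpace α] [MeasurableSpace β]
    (c : α → β → ℝ≥0∞) (μ : Measure α) (ν : Measure β) : ℝ≥0∞ :=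
  ⨅ γ ∈ couplings μ ν, ∫⁻ p, c p.1 p.2 ∂γ

/-- The probability measures on `A` with discrete support of size at most `k`, that is, the
measures `∑ i, w i • δ_{a i}` with weights `w i ≥ 0` of sum one and points `a i ∈ A`. -/
def discreteMeasures {α : Type*} [MeasurableSpace α] (k : ℕ) (A : Set α) : Set (Measure α) :=
  {ρ | ∃ (w : Fin k → ℝ≥0) (a : Fin k → α),
    ∑ i, w i = 1 ∧ (∀ i, a i ∈ A) ∧ ρ = ∑ i, w i • Measure.dirac (a i)}

/-- The latent optimal transport cost: `cx` is the cost from the source to the source anchors,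
`cz` the cost between the anchors, `cy` the cost from the target anchors to the target; there
are at most `kx` source anchors, taken in `Zx`, and at most `ky` target anchors, taken in
`Zy`. -/
noncomputable def latentOT {α : Type*} [MeasurableSpace α] (cx cz cy : α → α → ℝ≥0∞)
    (kx ky : ℕ) (Zx Zy : Set α) (μ ν : Measure α) : ℝ≥0∞ :=
  ⨅ ρ ∈ discreteMeasures kx Zx, ⨅ σ ∈ discreteMeasures ky Zy,
    otCost cx μ ρ + otCost cz ρ σ + otCost cy σ ν

/-- The squared Euclidean distance as a cost function. -/
noncomputable def sqCost {d : ℕ} (x y : EuclideanSpace ℝ (Fin d)) : ℝ≥0∞ :=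
  ENNReal.ofReal (‖x - y‖ ^ 2)

/-- The empirical measure `(1 / n) ∑ i, δ_{x i}` of the points `x 0, …, x (n - 1)`. -/
noncomputable def empirical {α : Type*} [MeasurableSpace α] {n : ℕ} (x : Fin n → α) :
    Measure α :=
  (n : ℝ≥0∞)⁻¹ • ∑ i, Measure.dirac (x i)

/-- The latent optimal transport cost on `ℝᵈ` with squared Euclidean outer costs, a finite
nonnegative inner cost `cz` and unrestricted anchors. -/
noncomputable def sqLatentOT {d : ℕ}
    (cz : EuclideanSpace ℝ (Fin d) → EuclideanSpace ℝ (Fin d) → ℝ≥0) (kx ky : ℕ)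
    (μ ν : Measure (EuclideanSpace ℝ (Fin d))) : ℝ≥0∞ :=
  latentOT sqCost (fun z w => (cz z w : ℝ≥0∞)) sqCost kx ky Set.univ Set.univ μ ν

end LatentOT

/-! Only the two outer legs of the latent cost see the data: for fixed anchor measures the inner leg
is the same for `μ`, `ν` and for their empirical versions. It therefore suffices to bound the change
of `otCost sqCost μ ρ` when `μ` becomes empirical, uniformly over all `ρ` with at most `k` atoms.

Anchors are unrestricted and `cz` is arbitrary, so compactness has to be earned. A plan that beats
the route through `0` contains a cheap pair of anchors near the data; mass on a pair with a far
anchor can be rerouted through that cheap pair without loss. The anchors may thus be confined to a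
ball whose radius depends on `R` and `cz 0 0` only (`exists_latentOT_closedBall_le`).

For confined anchors, semi-discrete duality with bounded potentials (`exists_bounded_potential`,
`ofReal_le_otCost`) writes the transport cost as a supremum of the mean of `min_i (‖x - a i‖² - φ
i)` plus `∑ i, φ i * w i`. The last term does not involve `μ`, so the weights disappear from the
comparison (`otCost_le_otCost_add`). What remains are minima of `k` quadratics, a Lipschitz family
indexed by a ball in `k * (d + 2)` real parameters. Chaining with Hoeffding's inequality
(`measure_exists_deviation_le`) controls their empirical means at rate `√((k + log (2 / δ)) / n)`,
which is at most a constant times the stated rate. -/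

namespace LatentOT

/-! ### Dyadic nets in finite-dimensional balls -/

section Nets

variable (W : Type*) [NormedAddCommGroup W] [NormedSpace ℝ W] [FiniteDimensional ℝ W]

/-- The unit ball of a finite-dimensional space has nets at all dyadic scales whose cardinality
grows geometrically. -/
lemma exists_dyadic_nets : ∃ A : ℕ, 1 ≤ A ∧ ∃ S : ℕ → Finset W, S 0 = {0} ∧
    (∀ l, (S l).card ≤ A ^ l) ∧
    ∀ l (w : W), ‖w‖ ≤ 1 → ∃ s ∈ S l, ‖w - s‖ ≤ (1 / 2) ^ l := by
  classical
  have : ProperSpace W := FiniteDimensional.proper ℝ W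
  obtain ⟨t, -, htf, ht⟩ := (isCompact_closedBall (0 : W) 1).finite_cover_balls
    (e := 1 / 2) (by norm_num)
  set T := htf.toFinset with hT
  have hcov : ∀ w : W, ‖w‖ ≤ 1 → ∃ s ∈ T, ‖w - s‖ ≤ 1 / 2 := by
    intro w hw
    have := ht (show w ∈ Metric.closedBall (0 : W) 1 by simpa using hw)
    simp only [Set.mem_iUnion, Metric.mem_ball, exists_prop] at this
    obtain ⟨s, hs, hd⟩ := this
    exact ⟨s, by simpa [hT] using hs, by rw [← dist_eq_norm]; exact hd.le⟩
  have hT1 : 1 ≤ T.card := by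
    obtain ⟨s, hs, -⟩ := hcov 0 (by simp)
    exact Finset.card_pos.2 ⟨s, hs⟩
  -- Successive refinement: the residual at level `l`, scaled by `2 ^ l`, lies in the unit ball
  -- again, so the single half-net `T` serves every scale and each level multiplies the cardinality
  -- by `T.card`.
  let S : ℕ → Finset W := fun l => Nat.rec {0}
    (fun l S => Finset.image₂ (fun s t : W => s + ((1 / 2 : ℝ) ^ l) • t) S T) l
  refine ⟨T.card, hT1, S, rfl, fun l => ?_, fun l => ?_⟩
  · induction l with
    | zero => simp [S]
    | succ l ih =>
      calc (S (l + 1)).card ≤ (S l).card * T.card := Finset.card_image₂_le _ _ _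
        _ ≤ T.card ^ l * T.card := by gcongr
        _ = _ := (pow_succ _ _).symm
  · induction l with
    | zero => intro w hw; exact ⟨0, by simp [S], by simpa using hw⟩
    | succ l ih =>
      intro w hw
      obtain ⟨s, hs, hd⟩ := ih w hw
      have h2 : (0 : ℝ) < (1 / 2) ^ l := by positivity
      obtain ⟨t, ht, hd'⟩ := hcov (((1 / 2 : ℝ) ^ l)⁻¹ • (w - s)) (by
        rw [norm_smul, norm_inv, Real.norm_of_nonneg h2.le, inv_mul_le_iff₀ h2]; simpa using hd)
      refine ⟨s + ((1 / 2 : ℝ) ^ l) • t, Finset.mem_image₂_of_mem hs ht, ?_⟩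
      have : w - (s + ((1 / 2 : ℝ) ^ l) • t)
          = ((1 / 2 : ℝ) ^ l) • (((1 / 2 : ℝ) ^ l)⁻¹ • (w - s) - t) := by
        rw [smul_sub, smul_inv_smul₀ h2.ne']; abel
      rw [this, norm_smul, Real.norm_of_nonneg h2.le, pow_succ]
      gcongr

/-- Dyadic nets of the ball of radius `r` of a finite power of a finite-dimensional space. -/
lemma exists_dyadic_nets_pi : ∃ A : ℕ, 1 ≤ A ∧ ∀ (k : ℕ) (r : ℝ), 0 ≤ r →
    ∃ S : ℕ → Finset (Fin k → W), S 0 = {0} ∧ (∀ l, (S l).card ≤ A ^ (k * l)) ∧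
    ∀ l (w : Fin k → W), ‖w‖ ≤ r → ∃ s ∈ S l, ‖w - s‖ ≤ r * (1 / 2) ^ l := by
  classical
  obtain ⟨A, hA, S, hS0, hSc, hS⟩ := exists_dyadic_nets W
  -- The power carries the sup norm, so a product of nets is a net at the same scale. `A` comes from
  -- `W` alone and is uniform in `k` and `r`.
  refine ⟨A, hA, fun k r hr => ⟨fun l =>
    Fintype.piFinset fun _ : Fin k => (S l).image (fun s => r • s), ?_, fun l => ?_,
    fun l w hw => ?_⟩⟩
  · ext s
    simp [hS0, funext_iff]
  · rw [Fintype.card_piFinset]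
    calc ∏ _i : Fin k, ((S l).image (fun s => r • s)).card ≤ ∏ _i : Fin k, A ^ l :=
          Finset.prod_le_prod' fun _ _ => Finset.card_image_le.trans (hSc l)
      _ = A ^ (k * l) := by simp [← pow_mul, mul_comm]
  · have : ∀ i, ∃ s ∈ S l, ‖w i - r • s‖ ≤ r * (1 / 2) ^ l := by
      intro i
      have hwi : ‖w i‖ ≤ r := (norm_le_pi_norm w i).trans hw
      rcases hr.eq_or_lt with rfl | hr
      · obtain ⟨s, hs, -⟩ := hS l 0 (by simp)
        exact ⟨s, hs, by simpa using hwi⟩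
      · obtain ⟨s, hs, hd⟩ := hS l (r⁻¹ • w i) (by
          rw [norm_smul, norm_inv, Real.norm_of_nonneg hr.le, inv_mul_le_iff₀ hr]; simpa using hwi)
        refine ⟨s, hs, ?_⟩
        have : w i - r • s = r • (r⁻¹ • w i - s) := by rw [smul_sub, smul_inv_smul₀ hr.ne']
        rw [this, norm_smul, Real.norm_of_nonneg hr.le]
        gcongr
    choose s hs hd using this
    refine ⟨fun i => r • s i, ?_, (pi_norm_le_iff_of_nonneg (by positivity)).2 hd⟩
    simp only [Fintype.mem_piFinset, Finset.mem_image]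
    exact fun i => ⟨s i, hs i, rfl⟩

end Nets

/-! ### Hoeffding's inequality and chaining -/

section Deviation

variable {α : Type*} [MeasurableSpace α] {Ω : Type*} [MeasurableSpace Ω]

/-- The upper tail of the sum of bounded centred i.i.d. variables. -/
lemma measure_sum_ge_le_exp {P : Measure Ω} [IsProbabilityMeasure P] {μ : Measure α} {n : ℕ}
    (hn : 1 ≤ n) {X : Fin n → Ω → α}
    (hX : ∀ i, HasLaw (X i) μ P) (hind : iIndepFun X P) {g : α → ℝ} (hg : Measurable g) {b : ℝ}
    (hb : 0 < b) (hgb : ∀ᵐ x ∂μ, |g x| ≤ b) {v : ℝ} (hv : 0 ≤ v) :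
    P {ω | b * √(2 * v / n) < (∑ i, g (X i ω)) / n - ∫ x, g x ∂μ} ≤ ENNReal.ofReal (Real.exp (-v)) := by
  have hn' : (0 : ℝ) < n := by exact_mod_cast hn
  have hae : ∀ i, ∀ᵐ ω ∂P, g (X i ω) ∈ Set.Icc (-b) b := fun i => by
    have := (hX i).map_eq ▸ hgb
    filter_upwards [ae_of_ae_map (hX i).aemeasurable this] with ω hω using abs_le.1 hω
  have hint : ∀ i, ∫ ω, g (X i ω) ∂P = ∫ x, g x ∂μ := fun i => by
    rw [← (hX i).map_eq, integral_map (hX i).aemeasurable hg.aestronglyMeasurable]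
  have hsub : ∀ i ∈ Finset.univ, HasSubgaussianMGF (fun ω => g (X i ω) - ∫ x, g x ∂μ)
      ((‖b - -b‖₊ / 2) ^ 2) P := fun i _ => by
    rw [← hint i]
    exact hasSubgaussianMGF_of_mem_Icc (hg.comp_aemeasurable (hX i).aemeasurable) (hae i)
  have hind' : iIndepFun (fun i ω => g (X i ω) - ∫ x, g x ∂μ) P :=
    hind.comp (fun _ x => g x - ∫ x, g x ∂μ) fun _ => hg.sub_const _
  -- Variables in `[-b, b]` have sub-Gaussian parameter `b ^ 2`; this `ε` makes the exponent exactly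
  -- `-v`.
  have key := HasSubgaussianMGF.measure_sum_ge_le_of_iIndepFun hind' hsub
    (ε := n * (b * √(2 * v / n))) (by positivity)
  have hc : (((‖b - -b‖₊ / 2) ^ 2 : ℝ≥0) : ℝ) = b ^ 2 := by
    push_cast
    rw [Real.norm_of_nonneg (by linarith)]
    ring
  have hexp : -(n * (b * √(2 * v / n))) ^ 2 /
      (2 * ((∑ _i : Fin n, (‖b - -b‖₊ / 2) ^ 2 : ℝ≥0) : ℝ)) = -v := by
    rw [Finset.sum_const, Finset.card_univ, Fintype.card_fin, nsmul_eq_mul, NNReal.coe_mul, hc,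
      mul_pow, mul_pow, Real.sq_sqrt (by positivity)]
    simp only [NNReal.coe_natCast]
    field_simp
  push_cast at key hexp
  rw [hexp] at key
  refine le_trans (measure_mono fun ω hω => ?_)
    ((ENNReal.le_ofReal_iff_toReal_le (measure_ne_top _ _) (Real.exp_pos _).le).2 key)
  simp only [Set.mem_ofPred_eq, Finset.sum_sub_distrib, Finset.sum_const, Finset.card_univ,
    Fintype.card_fin, nsmul_eq_mul] at hω ⊢
  have := mul_le_mul_of_nonneg_left hω.le hn'.le
  rwa [mul_sub, mul_div_cancel₀ _ hn'.ne'] at this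

/-- Hoeffding's inequality for the empirical mean of a bounded function. -/
lemma measure_abs_mean_sub_integral_le {P : Measure Ω} [IsProbabilityMeasure P] {μ : Measure α}
    {n : ℕ} (hn : 1 ≤ n)
    {X : Fin n → Ω → α} (hX : ∀ i, HasLaw (X i) μ P) (hind : iIndepFun X P) {g : α → ℝ}
    (hg : Measurable g) {b : ℝ} (hb : 0 < b) (hgb : ∀ᵐ x ∂μ, |g x| ≤ b) {v : ℝ} (hv : 0 ≤ v) :
    P {ω | b * √(2 * v / n) < |(∑ i, g (X i ω)) / n - ∫ x, g x ∂μ|} ≤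
      2 * ENNReal.ofReal (Real.exp (-v)) := by
  have h1 := measure_sum_ge_le_exp hn hX hind hg hb hgb hv
  have h2 := measure_sum_ge_le_exp hn hX hind hg.neg hb (by simpa using hgb) hv
  rw [two_mul (ENNReal.ofReal (Real.exp (-v)))]
  refine (measure_mono fun ω hω => ?_).trans ((measure_union_le _ _).trans (add_le_add h1 h2))
  rcases lt_abs.1 (Set.mem_ofPred_eq ▸ hω) with h | h
  · exact Or.inl h
  · refine Or.inr ?_
    simp only [Set.mem_ofPred_eq, Pi.neg_apply, Finset.sum_neg_distrib, integral_neg, neg_div]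
    linarith

lemma sum_range_succ_mul_half_pow_le (L : ℕ) :
    ∑ l ∈ Finset.range L, ((l : ℝ) + 1) * (1 / 2) ^ l ≤ 4 := by
  have : ∑ l ∈ Finset.range L, ((l : ℝ) + 1) * (1 / 2) ^ l = 4 - (2 * L + 4) * (1 / 2) ^ L := by
    induction L with
    | zero => simp
    | succ L ih => rw [Finset.sum_range_succ, ih]; push_cast; ring
  rw [this]
  have : (0 : ℝ) ≤ (2 * L + 4) * (1 / 2) ^ L := by positivity
  linarith

/-- Chaining along nets of geometrically growing cardinality: a uniform deviation bound for a
Lipschitz family of functions. -/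
lemma measure_exists_deviation_le {V : Type*} [NormedAddCommGroup V] {N : ℕ} (hN : 1 ≤ N) {r Λ : ℝ}
    (hr : 0 < r) (hΛ : 0 < Λ) {S : ℕ → Finset V} (hS0 : S 0 = {0})
    (hSc : ∀ l, (S l).card ≤ N ^ l)
    (hS : ∀ l (w : V), ‖w‖ ≤ r → ∃ s ∈ S l, ‖w - s‖ ≤ r * (1 / 2) ^ l)
    {P : Measure Ω} [IsProbabilityMeasure P] {μ : Measure α} [IsProbabilityMeasure μ] {n : ℕ}
    (hn : 1 ≤ n)
    {X : Fin n → Ω → α} (hX : ∀ i, HasLaw (X i) μ P) (hind : iIndepFun X P)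
    {K : Set α} (hK : ∀ᵐ x ∂μ, x ∈ K) {f : V → α → ℝ} (hf : ∀ θ, Measurable (f θ))
    (hf0 : ∀ x ∈ K, f 0 x = 0)
    (hfL : ∀ θ θ' x, x ∈ K → |f θ x - f θ' x| ≤ Λ * ‖θ - θ'‖) {δ : ℝ} (hδ : 0 < δ) (hδ1 : δ < 1) :
    P {ω | ∃ θ, ‖θ‖ ≤ r ∧ 8 * Λ * r * √(2 * (2 * Real.log N + Real.log (8 / δ)) / n) <
        |(∑ i, f θ (X i ω)) / n - ∫ x, f θ x ∂μ|} ≤ ENNReal.ofReal (δ / 2) := by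
  -- Chosen so that `exp (-v) = δ / (8 * N ^ 2)`. Level `l` is tested at `(l + 1) * v`: the power `N
  -- ^ (2 * (l + 1))` absorbs the at most `N ^ (2 * l + 1)` pairs of net points, and the remaining
  -- failure probabilities sum to `δ / 2`.
  set v : ℝ := 2 * Real.log N + Real.log (8 / δ) with hv
  have hn' : (0 : ℝ) < n := by exact_mod_cast hn
  have hN' : (1 : ℝ) ≤ N := by exact_mod_cast hN
  have hv0 : 0 ≤ v := add_nonneg (mul_nonneg zero_le_two (Real.log_nonneg hN'))
    (Real.log_nonneg (by rw [le_div_iff₀ hδ]; linarith))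
  set G : V → Ω → ℝ := fun θ ω => (∑ i, f θ (X i ω)) / n - ∫ x, f θ x ∂μ with hG
  have hfint : ∀ θ, Integrable (f θ) μ := fun θ => by
    refine Integrable.of_bound (hf θ).aestronglyMeasurable (Λ * ‖θ‖) ?_
    filter_upwards [hK] with x hx
    simpa [hf0 x hx] using hfL θ 0 x hx
  let b : ℕ → ℝ := fun l => 2 * Λ * r * (1 / 2) ^ l
  have hb : ∀ l, 0 < b l := fun l => by positivity
  let u : ℕ → ℝ := fun l => b l * √(2 * ((l + 1) * v) / n)
  let Bad : ℕ → Set Ω := fun l => ⋃ s ∈ S l, ⋃ s' ∈ (S (l + 1)).filter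
    (fun s' => ‖s' - s‖ ≤ 2 * r * (1 / 2) ^ l), {ω | u l < |G s' ω - G s ω|}
  let Null : Set Ω := {ω | ¬ ∀ i, X i ω ∈ K}
  have hNull : P Null = 0 := by
    have : ∀ᵐ ω ∂P, ∀ i, X i ω ∈ K := ae_all_iff.2 fun i =>
      ae_of_ae_map (hX i).aemeasurable ((hX i).map_eq.symm ▸ hK)
    exact this
  have hpair : ∀ l s s', ‖s' - s‖ ≤ 2 * r * (1 / 2) ^ l →
      P {ω | u l < |G s' ω - G s ω|} ≤ 2 * ENNReal.ofReal (Real.exp (-((l + 1) * v))) := by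
    intro l s s' hss
    have := measure_abs_mean_sub_integral_le hn hX hind ((hf s').sub (hf s)) (hb l) (by
      filter_upwards [hK] with x hx
      refine (hfL s' s x hx).trans ((mul_le_mul_of_nonneg_left hss hΛ.le).trans (le_of_eq ?_))
      simp only [b]; ring) (v := (l + 1) * v) (by positivity)
    convert this using 5 with ω
    simp only [hG, Pi.sub_apply, Finset.sum_sub_distrib, integral_sub (hfint s') (hfint s)]
    ring_nf
  have hexp : Real.exp (-v) = (N ^ 2 : ℝ)⁻¹ * (δ / 8) := by
    rw [hv, Real.exp_neg, Real.exp_add, Real.exp_log (by positivity), two_mul, Real.exp_add,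
      Real.exp_log (by linarith), mul_inv, inv_div, pow_two]
  have hBad : ∀ l, P (Bad l) ≤ ENNReal.ofReal (δ / 4) * (1 / 2) ^ l := by
    intro l
    have h1 : P (Bad l) ≤ ∑ s ∈ S l, ∑ s' ∈ (S (l + 1)).filter
        (fun s' => ‖s' - s‖ ≤ 2 * r * (1 / 2) ^ l),
        2 * ENNReal.ofReal (Real.exp (-((l + 1) * v))) := by
      refine (measure_biUnion_finset_le _ _).trans (Finset.sum_le_sum fun s hs => ?_)
      refine (measure_biUnion_finset_le _ _).trans (Finset.sum_le_sum fun s' hs' => ?_)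
      exact hpair l s s' (Finset.mem_filter.1 hs').2
    have h2 : ∑ s ∈ S l, ∑ s' ∈ (S (l + 1)).filter
        (fun s' => ‖s' - s‖ ≤ 2 * r * (1 / 2) ^ l),
        2 * ENNReal.ofReal (Real.exp (-((l + 1) * v))) ≤
        ((N ^ l * N ^ (l + 1) : ℕ) : ℝ≥0∞) * (2 * ENNReal.ofReal (Real.exp (-((l + 1) * v)))) := by
      simp only [Finset.sum_const, nsmul_eq_mul]
      rw [← Finset.sum_mul]
      gcongr
      rw [← Nat.cast_sum]
      gcongr
      calc _ ≤ ∑ s ∈ S l, N ^ (l + 1) := Finset.sum_le_sum fun s _ =>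
            (Finset.card_filter_le _ _).trans (hSc _)
        _ ≤ _ := by rw [Finset.sum_const, smul_eq_mul]; gcongr; exact hSc l
    refine h1.trans (h2.trans ?_)
    have h3 : (1 / 2 : ℝ≥0∞) = ENNReal.ofReal (1 / 2) := by
      rw [ENNReal.ofReal_div_of_pos two_pos]; simp
    rw [h3, ← ENNReal.ofReal_pow (by norm_num), ← ENNReal.ofReal_mul (by positivity),
      ← ENNReal.ofReal_natCast, show (2 : ℝ≥0∞) = ENNReal.ofReal 2 by simp,
      ← ENNReal.ofReal_mul (by norm_num), ← ENNReal.ofReal_mul (by positivity)]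
    apply ENNReal.ofReal_le_ofReal
    have h4 : Real.exp (-((l + 1) * v)) = ((N ^ 2 : ℝ)⁻¹ * (δ / 8)) ^ (l + 1) := by
      rw [← hexp, ← Real.exp_nat_mul]; push_cast; ring_nf
    have h5 : (δ / 8) ^ l ≤ (1 / 2 : ℝ) ^ l := by gcongr; linarith
    have h6 : ((N : ℝ) ^ l * N ^ (l + 1)) * ((N ^ 2 : ℝ)⁻¹) ^ (l + 1) ≤ 1 := by
      rw [inv_pow, ← div_eq_mul_inv, div_le_one (by positivity), ← pow_add, ← pow_mul]
      exact pow_le_pow_right₀ hN' (by omega)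
    rw [h4, mul_pow, pow_succ (δ / 8)]
    push_cast
    calc _ = (((N : ℝ) ^ l * N ^ (l + 1)) * ((N ^ 2 : ℝ)⁻¹) ^ (l + 1)) * ((δ / 4) * (δ / 8) ^ l) := by
          ring
      _ ≤ 1 * ((δ / 4) * (1 / 2) ^ l) := by gcongr
      _ = _ := one_mul _
  -- The uncountable family of parameters is handled by a deterministic inclusion into countably
  -- many bad events: off them, `G` is telescoped along net points approaching `θ`.
  have hsub : {ω | ∃ θ, ‖θ‖ ≤ r ∧ 8 * Λ * r * √(2 * v / n) < |G θ ω|} ⊆ Null ∪ ⋃ l, Bad l := by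
    rintro ω ⟨θ, hθ, hlt⟩
    by_contra hω
    simp only [Set.mem_union, Set.mem_iUnion, not_or, not_exists] at hω
    obtain ⟨hω1, hω2⟩ := hω
    have hXK : ∀ i, X i ω ∈ K := by simpa [Null] using hω1
    choose s hsS hs using fun l => hS l θ hθ
    have hs0 : s 0 = 0 := by simpa [hS0] using hsS 0
    have hG0 : G 0 ω = 0 := by
      have : ∫ x, f 0 x ∂μ = 0 := by
        rw [integral_congr_ae (g := fun _ => (0 : ℝ)) (by filter_upwards [hK] with x hx using hf0 x hx)]
        simp
      simp [hG, this, hf0 _ (hXK _)]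
    have hGL : ∀ θ θ', |G θ ω - G θ' ω| ≤ 2 * Λ * ‖θ - θ'‖ := by
      intro θ θ'
      have e : G θ ω - G θ' ω = (∑ i, (f θ (X i ω) - f θ' (X i ω))) / n -
          ∫ x, (f θ x - f θ' x) ∂μ := by
        simp only [hG, Finset.sum_sub_distrib, integral_sub (hfint θ) (hfint θ')]; ring
      have e1 : |(∑ i, (f θ (X i ω) - f θ' (X i ω))) / n| ≤ Λ * ‖θ - θ'‖ := by
        rw [abs_div, Nat.abs_cast, div_le_iff₀ hn']
        refine (Finset.abs_sum_le_sum_abs _ _).trans ((Finset.sum_le_sum fun i _ =>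
          hfL θ θ' _ (hXK i)).trans (le_of_eq ?_))
        simp [mul_comm]
      have e2 : |∫ x, (f θ x - f θ' x) ∂μ| ≤ Λ * ‖θ - θ'‖ := by
        have := norm_integral_le_of_norm_le_const (μ := μ) (f := fun x => f θ x - f θ' x)
          (C := Λ * ‖θ - θ'‖) (by filter_upwards [hK] with x hx using hfL θ θ' x hx)
        simpa using this
      rw [e]
      refine (abs_sub _ _).trans ?_
      linarith
    have hstep : ∀ l, |G (s (l + 1)) ω - G (s l) ω| ≤ u l := by
      intro l
      by_contra hcon
      refine hω2 l (Set.mem_biUnion (hsS l) (Set.mem_biUnion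
        (Finset.mem_filter.2 ⟨hsS (l + 1), ?_⟩) (not_le.1 hcon)))
      have : s (l + 1) - s l = (θ - s l) - (θ - s (l + 1)) := by abel
      rw [this]
      refine (norm_sub_le _ _).trans ((add_le_add (hs l) (hs (l + 1))).trans ?_)
      rw [pow_succ]
      have : 0 ≤ r * (1 / 2) ^ l := by positivity
      linarith
    -- Replacing `√(l + 1)` by `l + 1` gives a series with sum `4`, whence the constant `8 = 2 * 4`.
    have hu : ∀ l, u l ≤ 2 * Λ * r * √(2 * v / n) * (((l : ℝ) + 1) * (1 / 2) ^ l) := by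
      intro l
      have : √(2 * ((l + 1) * v) / n) ≤ (l + 1) * √(2 * v / n) := by
        rw [show 2 * ((l + 1) * v) / n = (l + 1) * (2 * v / n) by ring,
          Real.sqrt_mul (by positivity)]
        gcongr
        rw [Real.sqrt_le_left (by positivity)]
        nlinarith [(Nat.cast_nonneg l : (0 : ℝ) ≤ l)]
      calc u l ≤ b l * ((l + 1) * √(2 * v / n)) := by simp only [u]; gcongr
        _ = _ := by simp only [b]; ring
    have hGs : ∀ L, |G (s L) ω| ≤ 8 * Λ * r * √(2 * v / n) := by
      intro L
      have h1 : |G (s L) ω| ≤ ∑ l ∈ Finset.range L, u l := by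
        have : G (s L) ω = ∑ l ∈ Finset.range L, (G (s (l + 1)) ω - G (s l) ω) := by
          rw [Finset.sum_range_sub (fun l => G (s l) ω), hs0, hG0, sub_zero]
        rw [this]
        exact (Finset.abs_sum_le_sum_abs _ _).trans (Finset.sum_le_sum fun l _ => hstep l)
      refine h1.trans ((Finset.sum_le_sum fun l _ => hu l).trans ?_)
      rw [← Finset.mul_sum]
      have := mul_le_mul_of_nonneg_left (sum_range_succ_mul_half_pow_le L)
        (show 0 ≤ 2 * Λ * r * √(2 * v / n) by positivity)
      linarith
    have hlim : Filter.Tendsto (fun L : ℕ => 8 * Λ * r * √(2 * v / n) +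
        2 * Λ * (r * (1 / 2) ^ L)) Filter.atTop
        (nhds (8 * Λ * r * √(2 * v / n) + 2 * Λ * (r * 0))) :=
      ((((tendsto_pow_atTop_nhds_zero_of_lt_one (by norm_num) (by norm_num)).const_mul _).const_mul
        _).const_add _)
    have := ge_of_tendsto' hlim (b := |G θ ω|) fun L => by
      have h1 := hGL θ (s L)
      have h2 := hGs L
      have h3 := mul_le_mul_of_nonneg_left (hs L) (show 0 ≤ 2 * Λ by positivity)
      have h4 := abs_sub_abs_le_abs_sub (G θ ω) (G (s L) ω)
      linarith
    linarith
  refine (measure_mono hsub).trans ((measure_union_le _ _).trans ?_)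
  rw [hNull, zero_add]
  refine (measure_iUnion_le _).trans ((ENNReal.tsum_le_tsum hBad).trans ?_)
  rw [ENNReal.tsum_mul_left]
  simp only [one_div]
  rw [ENNReal.tsum_geometric_two, show (2 : ℝ≥0∞) = ENNReal.ofReal 2 by simp,
    ← ENNReal.ofReal_mul (by positivity)]
  apply ENNReal.ofReal_le_ofReal
  linarith

end Deviation

/-! ### Semi-discrete duality by convex separation -/

section Duality

variable {ι α : Type*} [Fintype ι] [MeasurableSpace α]

/-- A measurable assignment of each point of `α` to the indices in `ι`, with fractions allowed. -/
structure IsAssignment (p : ι → α → ℝ) : Prop where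
  measurable : ∀ i, Measurable (p i)
  nonneg : ∀ i x, 0 ≤ p i x
  sum_eq_one : ∀ x, ∑ i, p i x = 1

namespace IsAssignment

variable {p q : ι → α → ℝ} {μ : Measure α}

lemma le_one (hp : IsAssignment p) (i : ι) (x : α) : p i x ≤ 1 :=
  hp.sum_eq_one x ▸ Finset.single_le_sum (fun j _ => hp.nonneg j x) (Finset.mem_univ i)

lemma integrable [IsProbabilityMeasure μ] (hp : IsAssignment p) (i : ι) : Integrable (p i) μ :=
  Integrable.of_bound (hp.measurable i).aestronglyMeasurable 1
    (ae_of_all _ fun x => by rw [Real.norm_of_nonneg (hp.nonneg i x)]; exact hp.le_one i x)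

lemma integrable_mul (hp : IsAssignment p) (i : ι) {c : α → ℝ} (hc : Integrable c μ) :
    Integrable (fun x => p i x * c x) μ :=
  hc.bdd_mul (hp.measurable i).aestronglyMeasurable (c := 1)
    (ae_of_all _ fun x => by rw [Real.norm_of_nonneg (hp.nonneg i x)]; exact hp.le_one i x)

variable [IsProbabilityMeasure μ]

lemma sum_integral (hp : IsAssignment p) : ∑ i, ∫ x, p i x ∂μ = 1 := by
  rw [← integral_finsetSum _ fun i _ => hp.integrable i]
  simp [hp.sum_eq_one]

lemma combo (hp : IsAssignment p) (hq : IsAssignment q) {a b : ℝ} (ha : 0 ≤ a) (hb : 0 ≤ b)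
    (hab : a + b = 1) : IsAssignment fun i x => a * p i x + b * q i x where
  measurable i := ((hp.measurable i).const_mul a).add ((hq.measurable i).const_mul b)
  nonneg i x := add_nonneg (mul_nonneg ha (hp.nonneg i x)) (mul_nonneg hb (hq.nonneg i x))
  sum_eq_one x := by
    rw [Finset.sum_add_distrib, ← Finset.mul_sum, ← Finset.mul_sum, hp.sum_eq_one,
      hq.sum_eq_one, mul_one, mul_one, hab]

/-- An assignment can be modified to have prescribed weights, at a cost controlled by the distance
between the weights. -/
lemma exists_integral_eq (hp : IsAssignment p) {w : ι → ℝ} (hw : ∀ i, 0 ≤ w i)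
    (hw1 : ∑ i, w i = 1) {c : ι → α → ℝ} (hc : ∀ i, Integrable (c i) μ) {L : ℝ}
    (hL : 0 ≤ L) (hcL : ∀ i, ∀ᵐ x ∂μ, 0 ≤ c i x ∧ c i x ≤ L) :
    ∃ p' : ι → α → ℝ, IsAssignment p' ∧ (∀ i, ∫ x, p' i x ∂μ = w i) ∧
      ∑ i, ∫ x, p' i x * c i x ∂μ ≤
        ∑ i, ∫ x, p i x * c i x ∂μ + L * ∑ i, |w i - ∫ x, p i x ∂μ| := by
  classical
  set u : ι → ℝ := fun i => ∫ x, p i x ∂μ with hu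
  have hu0 : ∀ i, 0 ≤ u i := fun i => integral_nonneg (hp.nonneg i)
  have hu1 : ∑ i, u i = 1 := hp.sum_integral
  set e : ι → ℝ := fun i => w i - min (w i) (u i) with he
  have he0 : ∀ i, 0 ≤ e i := fun i => sub_nonneg.2 (min_le_left _ _)
  set m : ℝ := ∑ i, e i with hm
  have hm0 : 0 ≤ m := Finset.sum_nonneg fun i _ => he0 i
  have hm' : ∑ i, (u i - min (w i) (u i)) = m := by
    simp only [hm, he, Finset.sum_sub_distrib, hu1, hw1]
  rcases hm0.eq_or_lt with hmz | hmpos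
  · refine ⟨p, hp, fun i => ?_, le_add_of_nonneg_right
      (mul_nonneg hL (Finset.sum_nonneg fun i _ => abs_nonneg _))⟩
    have h1 := (Finset.sum_eq_zero_iff_of_nonneg fun i _ => he0 i).1 hmz.symm i (Finset.mem_univ i)
    have h2 := (Finset.sum_eq_zero_iff_of_nonneg
      fun i _ => sub_nonneg.2 (min_le_right (w i) (u i))).1 (hm'.trans hmz.symm) i
      (Finset.mem_univ i)
    change u i = w i
    simp only [he] at h1
    linarith
  -- Keep the fraction `r i` of what goes to `i`, pool the released mass in `q`, and hand it out in
  -- proportion to the deficits `e i`. Total excess and total deficit are both `m`, and moving mass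
  -- costs at most `L` per unit.
  set r : ι → ℝ := fun i => min (w i) (u i) / u i with hr
  have hr0 : ∀ i, 0 ≤ r i := fun i => div_nonneg (le_min (hw i) (hu0 i)) (hu0 i)
  have hr1 : ∀ i, r i ≤ 1 := fun i => div_le_one_of_le₀ (min_le_right _ _) (hu0 i)
  have hru : ∀ i, r i * u i = min (w i) (u i) := by
    intro i
    rcases (hu0 i).eq_or_lt with h | h
    · rw [← h, mul_zero, min_eq_right (hw i)]
    · simp only [hr]; field_simp
  set q : α → ℝ := fun x => ∑ j, (1 - r j) * p j x with hq
  have hq0 : ∀ x, 0 ≤ q x := fun x => Finset.sum_nonneg fun j _ =>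
    mul_nonneg (sub_nonneg.2 (hr1 j)) (hp.nonneg j x)
  have hqm : Measurable q := Finset.measurable_sum _ fun j _ => (hp.measurable j).const_mul _
  have hqi : Integrable q μ := integrable_finsetSum _ fun j _ => (hp.integrable j).const_mul _
  have hqint : ∫ x, q x ∂μ = m := by
    simp only [hq]
    rw [integral_finsetSum _ fun j _ => (hp.integrable j).const_mul _, ← hm']
    refine Finset.sum_congr rfl fun j _ => ?_
    rw [integral_const_mul, sub_mul, one_mul, hru]
  have hp' : IsAssignment fun i x => r i * p i x + e i / m * q x :=
    { measurable := fun i => ((hp.measurable i).const_mul _).add (hqm.const_mul _)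
      nonneg := fun i x => add_nonneg (mul_nonneg (hr0 i) (hp.nonneg i x))
        (mul_nonneg (div_nonneg (he0 i) hm0) (hq0 x))
      sum_eq_one := fun x => by
        rw [Finset.sum_add_distrib, ← Finset.sum_mul, ← Finset.sum_div, ← hm,
          div_self hmpos.ne', one_mul, ← hp.sum_eq_one x]
        simp only [hq]
        rw [← Finset.sum_add_distrib]
        exact Finset.sum_congr rfl fun i _ => by ring }
  refine ⟨_, hp', fun i => ?_, ?_⟩
  · rw [integral_add ((hp.integrable i).const_mul _) (hqi.const_mul _), integral_const_mul,
      integral_const_mul, hqint, div_mul_cancel₀ _ hmpos.ne']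
    change r i * u i + e i = w i
    rw [hru]; simp only [he]; ring
  · have h1 : ∀ i, ∫ x, (r i * p i x + e i / m * q x) * c i x ∂μ ≤
        ∫ x, p i x * c i x ∂μ + L * e i := by
      intro i
      have : ∫ x, (p i x * c i x + (L * (e i / m)) * q x) ∂μ =
          ∫ x, p i x * c i x ∂μ + L * e i := by
        rw [integral_add (hp.integrable_mul i (hc i)) (hqi.const_mul _), integral_const_mul, hqint]
        field_simp
      rw [← this]
      refine integral_mono_ae (hp'.integrable_mul i (hc i))
        ((hp.integrable_mul i (hc i)).add (hqi.const_mul _)) ?_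
      filter_upwards [hcL i] with x hx
      have h2 : r i * p i x * c i x ≤ p i x * c i x := mul_le_mul_of_nonneg_right
        (mul_le_of_le_one_left (hp.nonneg i x) (hr1 i)) hx.1
      have h3 : e i / m * q x * c i x ≤ e i / m * q x * L := mul_le_mul_of_nonneg_left hx.2
        (mul_nonneg (div_nonneg (he0 i) hm0) (hq0 x))
      rw [add_mul]
      linarith
    refine (Finset.sum_le_sum fun i _ => h1 i).trans ?_
    rw [Finset.sum_add_distrib, ← Finset.mul_sum]
    gcongr with i
    simp only [he]
    rcases min_cases (w i) (u i) with h | h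
    · rw [h.1, sub_self]; exact abs_nonneg _
    · rw [h.1]; exact le_abs_self _

variable [Nonempty ι]

/-- Assigning each point to the minimisers of `g` at that point. -/
lemma exists_argmin {g : ι → α → ℝ} (hg : ∀ i, Measurable (g i)) :
    ∃ p : ι → α → ℝ, IsAssignment p ∧
      ∀ x, ∑ i, p i x * g i x = Finset.univ.inf' Finset.univ_nonempty fun i => g i x := by
  classical
  set M : α → ℝ := fun x => Finset.univ.inf' Finset.univ_nonempty fun i => g i x with hM
  have hMm : Measurable M := by
    simp only [hM, Finset.inf'_univ_eq_ciInf]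
    exact Measurable.iInf hg
  -- Ties are shared equally among all minimisers, which avoids a measurable selection.
  set t : ι → α → ℝ := fun i => Set.indicator {x | g i x ≤ M x} 1 with ht
  have htm : ∀ i, Measurable (t i) := fun i =>
    measurable_one.indicator (measurableSet_le (hg i) hMm)
  have ht0 : ∀ i x, 0 ≤ t i x := fun i x => Set.indicator_nonneg (fun _ _ => zero_le_one) x
  have hpos : ∀ x, 0 < ∑ i, t i x := by
    intro x
    obtain ⟨i, -, hi⟩ := Finset.exists_mem_eq_inf' Finset.univ_nonempty fun i => g i x
    refine Finset.sum_pos' (fun i _ => ht0 i x) ⟨i, Finset.mem_univ i, ?_⟩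
    have : x ∈ {x | g i x ≤ M x} := hi.ge
    simp only [ht, Set.indicator_of_mem this]
    exact zero_lt_one
  refine ⟨fun i x => t i x / ∑ j, t j x, ⟨fun i => (htm i).div
    (Finset.measurable_sum _ fun j _ => htm j), fun i x => div_nonneg (ht0 i x) (hpos x).le,
    fun x => by rw [← Finset.sum_div, div_self (hpos x).ne']⟩, fun x => ?_⟩
  have : ∀ i, t i x * g i x = t i x * M x := by
    intro i
    by_cases h : x ∈ {x | g i x ≤ M x}
    · have h' : g i x = M x := le_antisymm h (Finset.inf'_le _ (Finset.mem_univ i))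
      rw [h']
    · simp only [ht, Set.indicator_of_notMem h, zero_mul]
  calc ∑ i, t i x / (∑ j, t j x) * g i x = ∑ i, t i x * M x / (∑ j, t j x) :=
        Finset.sum_congr rfl fun i _ => by rw [← this i]; ring
    _ = M x := by rw [← Finset.sum_div, ← Finset.sum_mul, mul_div_cancel_left₀ _ (hpos x).ne']

end IsAssignment

/-- A lower bound for a convex set of pairs (weights, cost) that holds up to an exact penalty comes
from a bounded price vector. -/
lemma exists_price {A : Set ((ι → ℝ) × ℝ)} (hA : Convex ℝ A) (hAn : A.Nonempty) {w : ι → ℝ}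
    {L s : ℝ} (hL : 0 ≤ L) (hs : ∀ q ∈ A, s ≤ q.2 + L * ∑ i, |w i - q.1 i|) :
    ∃ φ : ι → ℝ, (∀ i, |φ i| ≤ L) ∧ ∀ q ∈ A, s + ∑ i, φ i * q.1 i ≤ q.2 + ∑ i, φ i * w i := by
  classical
  -- An open convex cone below the apex `(w, s)`, disjoint from `A` by the penalty bound. The slope
  -- of a separating hyperplane is the price vector, and the opening of the cone bounds it by `L`.
  set U : Set ((ι → ℝ) × ℝ) := {q | q.2 + L * ∑ i, |w i - q.1 i| < s} with hU
  have hUo : IsOpen U := isOpen_lt (by fun_prop) continuous_const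
  have hUc : Convex ℝ U := by
    intro x hx y hy a b ha hb hab
    simp only [hU, Set.mem_ofPred_eq] at hx hy ⊢
    have h1 : ∑ i, |w i - (a • x + b • y).1 i| ≤
        a * ∑ i, |w i - x.1 i| + b * ∑ i, |w i - y.1 i| := by
      rw [Finset.mul_sum, Finset.mul_sum, ← Finset.sum_add_distrib]
      refine Finset.sum_le_sum fun i _ => ?_
      have : w i - (a • x + b • y).1 i = a * (w i - x.1 i) + b * (w i - y.1 i) := by
        simp only [Prod.fst_add, Prod.smul_fst, Pi.add_apply, Pi.smul_apply, smul_eq_mul]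
        linear_combination -(w i) * hab
      rw [this]
      refine (abs_add_le _ _).trans ?_
      rw [abs_mul, abs_mul, abs_of_nonneg ha, abs_of_nonneg hb]
    have h2 := mul_le_mul_of_nonneg_left h1 hL
    have h3 : (a • x + b • y).2 = a * x.2 + b * y.2 := by simp
    rw [h3]
    rcases ha.eq_or_lt with rfl | ha
    · have : b = 1 := by linarith
      subst this; linarith
    · have h4 := mul_lt_mul_of_pos_left hx ha
      have h5 := mul_le_mul_of_nonneg_left hy.le hb
      have h6 : a * s + b * s = s := by rw [← add_mul, hab, one_mul]
      linarith
  have hdisj : Disjoint U A := Set.disjoint_left.2 fun q hq hqA => not_le.2 hq (hs q hqA)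
  obtain ⟨f, β, hfU, hfA⟩ := geometric_hahn_banach_open hUc hUo hA hdisj
  set lam : ℝ := f (0, 1) with hlam
  set ψ : ι → ℝ := fun i => f (Pi.single i 1, 0) with hψ
  have hf : ∀ u t, f (u, t) = ∑ i, ψ i * u i + lam * t := by
    intro u t
    have h1 : (u, t) = ∑ i, u i • ((Pi.single i 1, 0) : (ι → ℝ) × ℝ) + t • ((0, 1) : (ι → ℝ) × ℝ) := by
      ext j
      · simp [Prod.fst_sum, Finset.sum_apply, Pi.single_apply]
      · simp [Prod.snd_sum]
    rw [h1, map_add, map_sum, map_smul, smul_eq_mul, mul_comm t]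
    congr 1
    exact Finset.sum_congr rfl fun i _ => by rw [map_smul, smul_eq_mul, mul_comm]
  have hUmem : ∀ (u : ι → ℝ) (t : ℝ), t + L * ∑ i, |w i - u i| < s → ∑ i, ψ i * u i + lam * t < β :=
    fun u t h => hf u t ▸ hfU (u, t) h
  -- `U` contains points arbitrarily far below any point of `A`, so the hyperplane is not vertical
  -- and has the right orientation.
  have hlampos : 0 < lam := by
    by_contra hcon
    push Not at hcon
    obtain ⟨⟨u, t⟩, hq⟩ := hAn
    have h1 := hfA _ hq
    rw [hf] at h1
    have h2 := hUmem u (min t (s - 1 - L * ∑ i, |w i - u i|)) (by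
      have := min_le_right t (s - 1 - L * ∑ i, |w i - u i|); linarith)
    have h3 := mul_le_mul_of_nonpos_left (min_le_left t (s - 1 - L * ∑ i, |w i - u i|)) hcon
    linarith
  have hψL : ∀ i, |ψ i| ≤ lam * L := by
    intro i
    by_contra hcon
    push Not at hcon
    obtain ⟨σ, hσ, hσ'⟩ : ∃ σ : ℝ, |σ| = 1 ∧ ψ i * σ = |ψ i| := by
      rcases abs_cases (ψ i) with h | h
      · exact ⟨1, by simp, by rw [h.1, mul_one]⟩
      · exact ⟨-1, by simp, by rw [h.1]; ring⟩
    -- Move along the side of the cone in direction `i`: a slope steeper than `L` would make the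
    -- functional unbounded above on `U`.
    have h1 : ∀ R : ℝ, 0 ≤ R →
        ∑ j, ψ j * w j + R * |ψ i| + lam * (s - 1 - L * R) < β := by
      intro R hR
      have h2 : ∑ j, |w j - (w + Pi.single i (R * σ) : ι → ℝ) j| = R := by
        rw [Finset.sum_eq_single i]
        · simp [abs_mul, hσ, abs_of_nonneg hR]
        · intro j _ hj; simp [Pi.single_eq_of_ne hj]
        · simp
      have h3 := hUmem (w + Pi.single i (R * σ)) (s - 1 - L * R) (by rw [h2]; linarith)
      have h4 : ∑ j, ψ j * (w + Pi.single i (R * σ) : ι → ℝ) j = ∑ j, ψ j * w j + R * |ψ i| := by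
        simp only [Pi.add_apply, mul_add, Finset.sum_add_distrib]
        congr 1
        rw [Finset.sum_eq_single i]
        · rw [Pi.single_eq_same, ← hσ']; ring
        · intro j _ hj; simp [Pi.single_eq_of_ne hj]
        · simp
      rwa [h4] at h3
    have hgap : 0 < |ψ i| - lam * L := sub_pos.2 hcon
    have h5 := h1 (max 0 ((β - ∑ j, ψ j * w j - lam * (s - 1)) / (|ψ i| - lam * L)))
      (le_max_left _ _)
    have h6 := (div_le_iff₀ hgap).1
      (le_max_right 0 ((β - ∑ j, ψ j * w j - lam * (s - 1)) / (|ψ i| - lam * L)))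
    linarith
  have hws : ∑ i, ψ i * w i + lam * s ≤ β := by
    refine le_of_forall_pos_le_add fun η hη => ?_
    have h1 := hUmem w (s - η / lam) (by
      have : 0 < η / lam := by positivity
      simp; linarith)
    rw [mul_sub, mul_div_cancel₀ _ hlampos.ne'] at h1
    linarith
  refine ⟨fun i => -(ψ i / lam), fun i => ?_, fun q hq => ?_⟩
  · rw [abs_neg, abs_div, abs_of_pos hlampos, div_le_iff₀ hlampos, mul_comm]
    exact hψL i
  · have h1 := hfA q hq
    rw [show q = (q.1, q.2) from rfl, hf] at h1
    have h2 : ∀ v : ι → ℝ, ∑ i, -(ψ i / lam) * v i = -((∑ i, ψ i * v i) / lam) := by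
      intro v
      rw [Finset.sum_div, ← Finset.sum_neg_distrib]
      exact Finset.sum_congr rfl fun i _ => by ring
    rw [h2, h2]
    have h3 := (hws.trans h1)
    have h4 : (∑ i, ψ i * w i) / lam + s ≤ (∑ i, ψ i * q.1 i) / lam + q.2 := by
      have := div_le_div_of_nonneg_right h3 hlampos.le
      rwa [add_div, add_div, mul_div_cancel_left₀ _ hlampos.ne',
        mul_div_cancel_left₀ _ hlampos.ne'] at this
    linarith

/-- Strong duality for the semi-discrete transport problem, with bounded potentials. -/
lemma exists_bounded_potential [Nonempty ι] {μ : Measure α} [IsProbabilityMeasure μ] {w : ι → ℝ}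
    (hw : ∀ i, 0 ≤ w i) (hw1 : ∑ i, w i = 1) {c : ι → α → ℝ} (hcm : ∀ i, Measurable (c i)) {L : ℝ}
    (hL : 0 ≤ L) (hcL : ∀ i, ∀ᵐ x ∂μ, 0 ≤ c i x ∧ c i x ≤ L) {s : ℝ}
    (hs : ∀ p : ι → α → ℝ, IsAssignment p → (∀ i, ∫ x, p i x ∂μ = w i) →
      s ≤ ∑ i, ∫ x, p i x * c i x ∂μ) :
    ∃ φ : ι → ℝ, (∀ i, |φ i| ≤ L) ∧
      s ≤ ∫ x, Finset.univ.inf' Finset.univ_nonempty (fun i => c i x - φ i) ∂μ +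
        ∑ i, φ i * w i := by
  have hc : ∀ i, Integrable (c i) μ := fun i =>
    Integrable.of_bound (hcm i).aestronglyMeasurable L (by
      filter_upwards [hcL i] with x hx
      rw [Real.norm_of_nonneg hx.1]; exact hx.2)
  set A : Set ((ι → ℝ) × ℝ) := {q | ∃ p : ι → α → ℝ, IsAssignment p ∧
    q = (fun i => ∫ x, p i x ∂μ, ∑ i, ∫ x, p i x * c i x ∂μ)} with hA
  have hAc : Convex ℝ A := by
    rintro _ ⟨p, hp, rfl⟩ _ ⟨p', hp', rfl⟩ a b ha hb hab
    refine ⟨_, hp.combo hp' ha hb hab, ?_⟩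
    ext i
    · simp only [Prod.fst_add, Prod.smul_fst, Pi.add_apply, Pi.smul_apply, smul_eq_mul]
      rw [integral_add ((hp.integrable i).const_mul _) ((hp'.integrable i).const_mul _),
        integral_const_mul, integral_const_mul]
    · simp only [Prod.snd_add, Prod.smul_snd, smul_eq_mul, Finset.mul_sum]
      rw [← Finset.sum_add_distrib]
      refine Finset.sum_congr rfl fun i _ => ?_
      rw [← integral_const_mul, ← integral_const_mul, ← integral_add
        ((hp.integrable_mul i (hc i)).const_mul _) ((hp'.integrable_mul i (hc i)).const_mul _)]
      exact integral_congr_ae (ae_of_all _ fun x => by ring)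
  obtain ⟨p₀, hp₀, -⟩ := IsAssignment.exists_argmin (ι := ι) (g := fun _ (_ : α) => (0 : ℝ))
    fun _ => measurable_const
  -- The penalty is exact because repairing the weights of an assignment costs at most `L` times
  -- their distance to `w`. Testing the resulting price inequality on the minimisers of `c i x - φ
  -- i` gives the dual bound.
  obtain ⟨φ, hφ, h⟩ := exists_price hAc ⟨_, p₀, hp₀, rfl⟩ (w := w) hL (s := s) (by
    rintro _ ⟨p, hp, rfl⟩
    obtain ⟨p', hp', hpw, hpc⟩ := hp.exists_integral_eq hw hw1 hc hL hcL
    exact (hs p' hp' hpw).trans hpc)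
  refine ⟨φ, hφ, ?_⟩
  obtain ⟨p, hp, hpm⟩ := IsAssignment.exists_argmin (g := fun i x => c i x - φ i)
    fun i => (hcm i).sub_const _
  have h1 := h _ ⟨p, hp, rfl⟩
  simp only at h1
  have h2 : ∫ x, Finset.univ.inf' Finset.univ_nonempty (fun i => c i x - φ i) ∂μ =
      ∑ i, ∫ x, p i x * c i x ∂μ - ∑ i, φ i * ∫ x, p i x ∂μ := by
    simp only [← hpm]
    have h3 : ∀ i, Integrable (fun x => p i x * (c i x - φ i)) μ := fun i =>
      hp.integrable_mul i ((hc i).sub (integrable_const _))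
    rw [integral_finsetSum _ fun i _ => h3 i, ← Finset.sum_sub_distrib]
    refine Finset.sum_congr rfl fun i _ => ?_
    rw [← integral_const_mul, ← integral_sub (hp.integrable_mul i (hc i))
      ((hp.integrable i).const_mul _)]
    exact integral_congr_ae (ae_of_all _ fun x => by ring)
  rw [h2]
  linarith

end Duality

/-! ### Splitting couplings -/

section Couplings

/-- A coupling splits along a finite decomposition of its second marginal. -/
lemma exists_split_of_mem_couplings {α β ι : Type*} [MeasurableSpace α] [StandardBorelSpace α]
    [Nonempty α] [MeasurableSpace β] [Fintype ι] {μ : Measure α} {ρ : ι → Measure β}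
    [∀ i, IsFiniteMeasure (ρ i)] {γ : Measure (α × β)} (hγ : γ ∈ couplings μ (∑ i, ρ i)) :
    ∃ γ' : ι → Measure (α × β), γ = ∑ i, γ' i ∧ ∀ i, (γ' i).map Prod.snd = ρ i := by
  have hfin : IsFiniteMeasure γ := by
    have : IsFiniteMeasure (γ.map Prod.snd) := by rw [hγ.2]; infer_instance
    exact Measure.isFiniteMeasure_of_map measurable_snd.aemeasurable
  set η : Measure (β × α) := γ.map Prod.swap with hη
  have hηfst : η.fst = ∑ i, ρ i := by
    rw [Measure.fst, hη, Measure.map_map measurable_fst measurable_swap, ← hγ.2]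
    rfl
  -- Disintegrate over the second coordinate and feed each `ρ i` to the same kernel. Splitting by
  -- summand, not by location, allows summands with overlapping supports, such as coinciding atoms.
  refine ⟨fun i => (ρ i ⊗ₘ η.condKernel).map Prod.swap, ?_, fun i => ?_⟩
  · have h1 : η = ∑ i, ρ i ⊗ₘ η.condKernel := by
      conv_lhs => rw [← η.disintegrate η.condKernel, hηfst]
      rw [← Measure.sum_fintype, Measure.compProd_sum_left, Measure.sum_fintype]
    have h2 : γ = η.map Prod.swap := by
      rw [hη, Measure.map_map measurable_swap measurable_swap]; simp
    conv_lhs => rw [h2, h1]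
    rw [← Measure.sum_fintype, Measure.map_sum measurable_swap.aemeasurable, Measure.sum_fintype]
  · rw [Measure.map_map measurable_snd measurable_swap]
    exact Measure.fst_compProd (ρ i) η.condKernel

lemma isProbabilityMeasure_of_mem_couplings {α β : Type*} [MeasurableSpace α] [MeasurableSpace β]
    {μ : Measure α} [IsProbabilityMeasure μ] {ν : Measure β} {γ : Measure (α × β)}
    (hγ : γ ∈ couplings μ ν) : IsProbabilityMeasure γ := by
  have : IsProbabilityMeasure (γ.map Prod.fst) := by rw [hγ.1]; infer_instance
  exact Measure.isProbabilityMeasure_of_map Prod.fst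

lemma ofReal_integral_le_lintegral {α : Type*} [MeasurableSpace α] {μ : Measure α} {g : α → ℝ}
    (hg : Integrable g μ) : ENNReal.ofReal (∫ x, g x ∂μ) ≤ ∫⁻ x, ENNReal.ofReal (g x) ∂μ := by
  rw [integral_eq_lintegral_pos_part_sub_lintegral_neg_part hg]
  refine ENNReal.ofReal_le_of_le_toReal (sub_le_self _ ENNReal.toReal_nonneg)

end Couplings

/-! ### Symmetry of the squared Euclidean transport cost -/

variable {d : ℕ}

local notation "𝔼" => EuclideanSpace ℝ (Fin d)

lemma measurable_sqCost : Measurable fun p : 𝔼 × 𝔼 => sqCost p.1 p.2 := by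
  unfold sqCost; fun_prop

lemma sqCost_comm (x y : 𝔼) : sqCost x y = sqCost y x := by
  rw [sqCost, sqCost, norm_sub_rev]

lemma otCost_sqCost_comm_le (μ ν : Measure 𝔼) : otCost sqCost μ ν ≤ otCost sqCost ν μ := by
  refine le_iInf₂ fun γ hγ => ?_
  have hmem : γ.map Prod.swap ∈ couplings μ ν := by
    constructor
    · rw [Measure.map_map measurable_fst measurable_swap, ← hγ.2]; rfl
    · rw [Measure.map_map measurable_snd measurable_swap, ← hγ.1]; rfl
  refine (iInf₂_le _ hmem).trans (le_of_eq ?_)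
  rw [lintegral_map measurable_sqCost measurable_swap]
  exact lintegral_congr fun p => sqCost_comm _ _

lemma otCost_sqCost_comm (μ ν : Measure 𝔼) : otCost sqCost μ ν = otCost sqCost ν μ :=
  le_antisymm (otCost_sqCost_comm_le μ ν) (otCost_sqCost_comm_le ν μ)

/-! ### Stability of transport to a discrete measure -/

section Stability

variable {ι : Type*} [Fintype ι] {μ : Measure (EuclideanSpace ℝ (Fin d))} [IsProbabilityMeasure μ]
  {a : ι → EuclideanSpace ℝ (Fin d)}

/-- An assignment with weights `w` bounds the transport cost to `∑ i, w i • δ_{a i}`. -/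
lemma otCost_le_of_isAssignment {p : ι → 𝔼 → ℝ} (hp : IsAssignment p) {w : ι → ℝ≥0}
    (hw : ∀ i, ∫ x, p i x ∂μ = w i) (ha : ∀ i, Integrable (fun x => ‖x - a i‖ ^ 2) μ) :
    otCost sqCost μ (∑ i, w i • Measure.dirac (a i)) ≤
      ENNReal.ofReal (∑ i, ∫ x, p i x * ‖x - a i‖ ^ 2 ∂μ) := by
  have hpm : ∀ i, Measurable fun x => ENNReal.ofReal (p i x) := fun i =>
    (hp.measurable i).ennreal_ofReal
  have hwd : ∑ i, μ.withDensity (fun x => ENNReal.ofReal (p i x)) = μ := by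
    ext s hs
    rw [Measure.finsetSum_apply]
    simp only [withDensity_apply _ hs]
    rw [← lintegral_finsetSum _ fun i _ => hpm i]
    have : ∀ x, ∑ i, ENNReal.ofReal (p i x) = 1 := fun x => by
      rw [← ENNReal.ofReal_sum_of_nonneg fun i _ => hp.nonneg i x, hp.sum_eq_one,
        ENNReal.ofReal_one]
    simp [this]
  have hmp : ∀ i, Measurable fun x : 𝔼 => (x, a i) := fun i => by fun_prop
  set γ : Measure (𝔼 × 𝔼) := ∑ i, (μ.withDensity fun x => ENNReal.ofReal (p i x)).map
    fun x => (x, a i) with hγ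
  have hmap : ∀ f : 𝔼 × 𝔼 → 𝔼, Measurable f → γ.map f =
      ∑ i, (μ.withDensity fun x => ENNReal.ofReal (p i x)).map fun x => f (x, a i) := by
    intro f hf
    rw [hγ, ← Measure.sum_fintype, Measure.map_sum hf.aemeasurable, Measure.sum_fintype]
    refine Finset.sum_congr rfl fun i _ => ?_
    rw [Measure.map_map hf (hmp i)]; rfl
  have hmem : γ ∈ couplings μ (∑ i, w i • Measure.dirac (a i)) := by
    constructor
    · rw [hmap _ measurable_fst]
      simpa using hwd
    · rw [hmap _ measurable_snd]
      refine Finset.sum_congr rfl fun i _ => ?_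
      simp only
      rw [Measure.map_const, withDensity_apply _ MeasurableSet.univ, Measure.restrict_univ,
        ← ofReal_integral_eq_lintegral_ofReal (hp.integrable i) (ae_of_all _ (hp.nonneg i)), hw i,
        ENNReal.ofReal_coe_nnreal]
      rfl
  refine (iInf₂_le γ hmem).trans (le_of_eq ?_)
  · rw [hγ, lintegral_finsetSum_measure, ENNReal.ofReal_sum_of_nonneg fun i _ =>
      integral_nonneg fun x => mul_nonneg (hp.nonneg i x) (by positivity)]
    refine Finset.sum_congr rfl fun i _ => ?_
    rw [lintegral_map measurable_sqCost (hmp i), lintegral_withDensity_eq_lintegral_mul _ (hpm i)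
      (by unfold sqCost; fun_prop), ofReal_integral_eq_lintegral_ofReal
      (hp.integrable_mul i (ha i))
      (ae_of_all _ fun x => mul_nonneg (hp.nonneg i x) (by positivity))]
    refine lintegral_congr fun x => ?_
    simp only [Pi.mul_apply, sqCost]
    rw [ENNReal.ofReal_mul (hp.nonneg i x)]

/-- Weak duality for the semi-discrete transport problem. -/
lemma ofReal_le_otCost {f : 𝔼 → ℝ} (hf : Integrable f μ) {φ : ι → ℝ} {w : ι → ℝ≥0}
    (h : ∀ i x, f x + φ i ≤ ‖x - a i‖ ^ 2) :
    ENNReal.ofReal (∫ x, f x ∂μ + ∑ i, φ i * w i) ≤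
      otCost sqCost μ (∑ i, w i • Measure.dirac (a i)) := by
  refine le_iInf₂ fun γ hγ => ?_
  have hγp := isProbabilityMeasure_of_mem_couplings hγ
  -- On the piece `γ' i` the second coordinate is almost surely `a i`, so the `i`-th pointwise
  -- inequality can be integrated there.
  obtain ⟨γ', hsum, hsnd⟩ := exists_split_of_mem_couplings hγ
  have hfγ : Integrable (fun p : 𝔼 × 𝔼 => f p.1) γ := by
    have : Integrable f (γ.map Prod.fst) := hγ.1.symm ▸ hf
    exact this.comp_measurable measurable_fst
  have hle : ∀ i, γ' i ≤ γ := fun i => by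
    rw [hsum]; exact Finset.single_le_sum (fun _ _ => Measure.zero_le _) (Finset.mem_univ i)
  have hfin : ∀ i, IsFiniteMeasure (γ' i) := fun i => isFiniteMeasure_of_le γ (hle i)
  have hfi : ∀ i, Integrable (fun p : 𝔼 × 𝔼 => f p.1) (γ' i) := fun i => hfγ.mono_measure (hle i)
  have huniv : ∀ i, (γ' i).real Set.univ = w i := by
    intro i
    have : (γ' i) Set.univ = (γ' i).map Prod.snd Set.univ := by
      rw [Measure.map_apply measurable_snd MeasurableSet.univ, Set.preimage_univ]
    rw [Measure.real, this, hsnd]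
    simp
  have hae : ∀ i, ∀ᵐ p ∂γ' i, p.2 = a i := by
    intro i
    have : ∀ᵐ z ∂(γ' i).map Prod.snd, z = a i := by
      rw [hsnd]
      exact Measure.ae_smul_measure ((ae_dirac_iff (measurableSet_singleton (a i))).2 rfl) _
    exact ae_of_ae_map measurable_snd.aemeasurable this
  have h1 : ∫ x, f x ∂μ + ∑ i, φ i * w i = ∑ i, ∫ p, (f p.1 + φ i) ∂γ' i := by
    have h2 : ∫ x, f x ∂μ = ∑ i, ∫ p, f p.1 ∂γ' i := by
      rw [← integral_finsetSum_measure fun i _ => hfi i, ← hsum, ← hγ.1,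
        integral_map measurable_fst.aemeasurable (hγ.1.symm ▸ hf.aestronglyMeasurable)]
    rw [h2, ← Finset.sum_add_distrib]
    refine Finset.sum_congr rfl fun i _ => ?_
    rw [integral_add (hfi i) (integrable_const _), integral_const, huniv, smul_eq_mul, mul_comm]
  rw [h1]
  refine (Finset.le_sum_of_subadditive ENNReal.ofReal ENNReal.ofReal_zero.le
    (fun _ _ => ENNReal.ofReal_add_le) _ _).trans ?_
  conv_rhs => rw [hsum]
  rw [lintegral_finsetSum_measure]
  refine Finset.sum_le_sum fun i _ => ?_
  refine (ofReal_integral_le_lintegral ((hfi i).add (integrable_const _))).trans ?_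
  refine lintegral_mono_ae ?_
  filter_upwards [hae i] with p hp
  rw [sqCost, hp]
  exact ENNReal.ofReal_le_ofReal (h i p.1)

/-- Stability of the transport cost to a discrete measure in the source measure, in terms of the
integrals of the functions `x ↦ min_i (‖x - a i‖² - φ i)`. -/
lemma otCost_le_otCost_add [Nonempty ι] {μ' : Measure 𝔼} [IsProbabilityMeasure μ'] {R B : ℝ}
    (hμ : ∀ᵐ x ∂μ, ‖x‖ ≤ R) (hμ' : ∀ᵐ x ∂μ', ‖x‖ ≤ R) (ha : ∀ i, ‖a i‖ ≤ B)
    {w : ι → ℝ≥0} (hw : ∑ i, w i = 1) {ε : ℝ}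
    (h : ∀ φ : ι → ℝ, (∀ i, |φ i| ≤ (R + B) ^ 2) →
      ∫ x, Finset.univ.inf' Finset.univ_nonempty (fun i => ‖x - a i‖ ^ 2 - φ i) ∂μ ≤
      ∫ x, Finset.univ.inf' Finset.univ_nonempty (fun i => ‖x - a i‖ ^ 2 - φ i) ∂μ' + ε) :
    otCost sqCost μ (∑ i, w i • Measure.dirac (a i)) ≤
      otCost sqCost μ' (∑ i, w i • Measure.dirac (a i)) + ENNReal.ofReal ε := by
  have hbd : ∀ i (x : 𝔼), ‖x‖ ≤ R → ‖x - a i‖ ^ 2 ≤ (R + B) ^ 2 := fun i x hx => by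
    gcongr
    exact (norm_sub_le _ _).trans (add_le_add hx (ha i))
  have hcL : ∀ i, ∀ᵐ x ∂μ, 0 ≤ ‖x - a i‖ ^ 2 ∧ ‖x - a i‖ ^ 2 ≤ (R + B) ^ 2 := fun i => by
    filter_upwards [hμ] with x hx
    exact ⟨by positivity, hbd i x hx⟩
  have hcm : ∀ i, Measurable fun x : 𝔼 => ‖x - a i‖ ^ 2 := fun i => by fun_prop
  have hint : ∀ i, Integrable (fun x => ‖x - a i‖ ^ 2) μ := fun i =>
    Integrable.of_bound (hcm i).aestronglyMeasurable ((R + B) ^ 2) (by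
      filter_upwards [hcL i] with x hx
      rw [Real.norm_of_nonneg hx.1]; exact hx.2)
  have hconst : IsAssignment fun i (_ : 𝔼) => (w i : ℝ) :=
    ⟨fun _ => measurable_const, fun i _ => (w i).2, fun _ => by exact_mod_cast hw⟩
  have hfin : otCost sqCost μ (∑ i, w i • Measure.dirac (a i)) ≠ ∞ :=
    ((otCost_le_of_isAssignment hconst (by simp) hint).trans_lt ENNReal.ofReal_lt_top).ne
  -- Strong duality at `μ`, transfer of the integral by `h`, then weak duality at `μ'` with the same
  -- potential; the term in `w` is common to both sides.
  obtain ⟨φ, hφL, hφ⟩ := exists_bounded_potential (μ := μ) (w := fun i => (w i : ℝ))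
    (fun i => (w i).2) (by exact_mod_cast hw) hcm (by positivity) hcL
    (s := (otCost sqCost μ (∑ i, w i • Measure.dirac (a i))).toReal) fun p hp hpw =>
      ENNReal.toReal_le_of_le_ofReal (Finset.sum_nonneg fun i _ => integral_nonneg fun x =>
        mul_nonneg (hp.nonneg i x) (by positivity)) (otCost_le_of_isAssignment hp hpw hint)
  have hmeas : Measurable fun x : 𝔼 =>
      Finset.univ.inf' Finset.univ_nonempty (fun i => ‖x - a i‖ ^ 2 - φ i) := by
    simp only [Finset.inf'_univ_eq_ciInf]
    exact Measurable.iInf fun i => (hcm i).sub_const _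
  have hint' : Integrable (fun x : 𝔼 =>
      Finset.univ.inf' Finset.univ_nonempty (fun i => ‖x - a i‖ ^ 2 - φ i)) μ' := by
    refine Integrable.of_bound hmeas.aestronglyMeasurable (2 * (R + B) ^ 2) ?_
    filter_upwards [hμ'] with x hx
    obtain ⟨i, -, hi⟩ := Finset.exists_mem_eq_inf' Finset.univ_nonempty
      fun i => ‖x - a i‖ ^ 2 - φ i
    rw [hi, Real.norm_eq_abs]
    refine (abs_sub _ _).trans ?_
    rw [abs_of_nonneg (by positivity)]
    linarith [hbd i x hx, hφL i]
  have hweak := ofReal_le_otCost (μ := μ') hint' (φ := φ) (w := w) (a := a) fun i x => by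
    have := Finset.inf'_le (fun i => ‖x - a i‖ ^ 2 - φ i) (Finset.mem_univ i)
    linarith
  rw [← ENNReal.ofReal_toReal hfin]
  refine (ENNReal.ofReal_le_ofReal (hφ.trans ?_)).trans
    (ENNReal.ofReal_add_le.trans (add_le_add_left hweak (ENNReal.ofReal ε)))
  linarith [h φ hφL]

end Stability

/-! ### Confining the anchors to a ball -/

section Confinement

/-- A probability measure carried by at most `k` points of `A` is in `discreteMeasures k A`. -/
lemma mem_discreteMeasures_of_finset {α : Type*} [MeasurableSpace α] [MeasurableSingletonClass α]
    {ρ : Measure α} [IsProbabilityMeasure ρ] {S : Finset α} (hS : S.Nonempty) {k : ℕ}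
    (hk : S.card ≤ k) {A : Set α} (hSA : ∀ s ∈ S, s ∈ A) (hρ : ρ (S : Set α)ᶜ = 0) :
    ρ ∈ discreteMeasures k A := by
  classical
  obtain ⟨s₀, hs₀⟩ := hS
  obtain ⟨e⟩ : Nonempty (S ↪ Fin k) :=
    Function.Embedding.nonempty_of_card_le (by simpa using hk)
  set w : Fin k → ℝ≥0 := Function.extend e (fun s => (ρ {(s : α)}).toNNReal) 0 with hw
  set a : Fin k → α := Function.extend e Subtype.val fun _ => s₀ with ha
  have hwe : ∀ s, w (e s) = (ρ {(s : α)}).toNNReal := fun s => e.injective.extend_apply _ _ s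
  have hae : ∀ s, a (e s) = s := fun s => e.injective.extend_apply _ _ s
  have hw0 : ∀ i, i ∉ Set.range e → w i = 0 := fun i hi =>
    Function.extend_apply' _ _ _ (by simpa using hi)
  have hmeas : ∀ t : Set α, MeasurableSet t → (∑ i, w i • Measure.dirac (a i)) t = ρ t := by
    intro t ht
    rw [Measure.finsetSum_apply]
    have h1 : ∑ s : S, ρ {(s : α)} * t.indicator 1 (s : α) =
        ∑ i, (w i • Measure.dirac (a i)) t := by
      refine Fintype.sum_of_injective e e.injective _ _ (fun i hi => ?_) fun s => ?_
      · simp [hw0 i hi]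
      · rw [hwe, hae, Measure.smul_apply, Measure.dirac_apply' _ ht, ENNReal.smul_def,
          ENNReal.coe_toNNReal (measure_ne_top _ _), smul_eq_mul]
    rw [← h1, Finset.sum_coe_sort S fun s => ρ {s} * t.indicator 1 s]
    have h2 : ∑ s ∈ S, ρ {s} * t.indicator 1 s = ∑ s ∈ S.filter (· ∈ t), ρ {s} := by
      rw [Finset.sum_filter]
      refine Finset.sum_congr rfl fun s _ => ?_
      by_cases h : s ∈ t <;> simp [h]
    rw [h2, sum_measure_singleton]
    refine le_antisymm (measure_mono fun x hx => by simp at hx; exact hx.2) ?_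
    calc ρ t ≤ ρ (↑(S.filter (· ∈ t)) ∪ (S : Set α)ᶜ) := measure_mono fun x hx => by
          by_cases h : x ∈ S
          · left; simp [h, hx]
          · right; simpa using h
      _ ≤ _ := (measure_union_le _ _).trans (by rw [hρ, add_zero])
  refine ⟨w, a, ?_, fun i => ?_, (Measure.ext hmeas).symm⟩
  · have := hmeas Set.univ MeasurableSet.univ
    simp only [measure_univ] at this
    rw [Measure.finsetSum_apply] at this
    simp only [Measure.smul_apply, measure_univ, ENNReal.smul_def, smul_eq_mul, mul_one] at this
    exact_mod_cast this
  · by_cases hi : i ∈ Set.range e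
    · obtain ⟨s, rfl⟩ := hi
      rw [hae]; exact hSA s s.2
    · rw [ha, Function.extend_apply' _ _ _ (by simpa using hi)]
      exact hSA s₀ hs₀

lemma exists_finset_of_mem_discreteMeasures {α : Type*} [MeasurableSpace α]
    [MeasurableSingletonClass α] {ρ : Measure α} {k : ℕ} {A : Set α}
    (hρ : ρ ∈ discreteMeasures k A) :
    IsProbabilityMeasure ρ ∧ ∃ S : Finset α, S.card ≤ k ∧ ρ (S : Set α)ᶜ = 0 := by
  classical
  obtain ⟨w, a, hw, -, rfl⟩ := hρ
  refine ⟨⟨?_⟩, Finset.univ.image a, Finset.card_image_le.trans (by simp), ?_⟩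
  · rw [Measure.finsetSum_apply]
    simp only [Measure.smul_apply, measure_univ, ENNReal.smul_def, smul_eq_mul, mul_one]
    exact_mod_cast hw
  · rw [Measure.finsetSum_apply]
    refine Finset.sum_eq_zero fun i _ => ?_
    rw [Measure.smul_apply, Measure.dirac_apply' _ (Finset.measurableSet _).compl]
    simp

/-- The least possible squared distance from `z` to a point of the ball of radius `R`. -/
noncomputable def sqExcess (R : ℝ) (z : 𝔼) : ℝ≥0∞ :=
  ENNReal.ofReal (max (‖z‖ - R) 0 ^ 2)

lemma measurable_sqExcess (R : ℝ) : Measurable (sqExcess R : 𝔼 → ℝ≥0∞) := by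
  unfold sqExcess; fun_prop

lemma sqExcess_le_sqCost {R : ℝ} {x z : 𝔼} (hx : ‖x‖ ≤ R) : sqExcess R z ≤ sqCost x z := by
  refine ENNReal.ofReal_le_ofReal ?_
  have h1 : ‖z‖ - ‖x‖ ≤ ‖x - z‖ := by rw [norm_sub_rev]; exact norm_sub_norm_le z x
  gcongr
  exact max_le (by linarith) (norm_nonneg _)

lemma le_sqExcess {R B : ℝ} (hRB : R ≤ B) {z : 𝔼} (hz : B ≤ ‖z‖) :
    ENNReal.ofReal ((B - R) ^ 2) ≤ sqExcess R z := by
  refine ENNReal.ofReal_le_ofReal ?_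
  have : B - R ≤ max (‖z‖ - R) 0 := le_max_of_le_left (by linarith)
  exact pow_le_pow_left₀ (by linarith) this 2

lemma norm_le_of_sqExcess_lt {R M : ℝ} {z : 𝔼} (h : sqExcess R z < ENNReal.ofReal M) :
    ‖z‖ ≤ R + √M := by
  have h1 : max (‖z‖ - R) 0 ^ 2 < M := by
    by_contra hcon
    exact not_le.2 h (ENNReal.ofReal_le_ofReal (not_lt.1 hcon))
  have h2 := Real.le_sqrt_of_sq_le h1.le
  linarith [le_max_left (‖z‖ - R) 0]

lemma sqCost_le {R : ℝ} {x z : 𝔼} (hx : ‖x‖ ≤ R) : sqCost x z ≤ ENNReal.ofReal ((R + ‖z‖) ^ 2) := by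
  refine ENNReal.ofReal_le_ofReal ?_
  have : ‖x - z‖ ≤ R + ‖z‖ := (norm_sub_le _ _).trans (by linarith)
  gcongr

lemma ae_fst_of_mem_couplings {α β : Type*} [MeasurableSpace α] [MeasurableSpace β] {μ : Measure α}
    {ν : Measure β} {γ : Measure (α × β)} (hγ : γ ∈ couplings μ ν) {p : α → Prop}
    (h : ∀ᵐ x ∂μ, p x) : ∀ᵐ q ∂γ, p q.1 :=
  ae_of_ae_map measurable_fst.aemeasurable (hγ.1.symm ▸ h)

lemma ae_snd_of_mem_couplings {α β : Type*} [MeasurableSpace α] [MeasurableSpace β] {μ : Measure α}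
    {ν : Measure β} {γ : Measure (α × β)} (hγ : γ ∈ couplings μ ν) {p : β → Prop}
    (h : ∀ᵐ x ∂ν, p x) : ∀ᵐ q ∂γ, p q.2 :=
  ae_of_ae_map measurable_snd.aemeasurable (hγ.2.symm ▸ h)

/-- The positions of the anchors alone force a cost, whichever coupling is used; this is what
rerouting gains back. -/
lemma lintegral_sqExcess_le {μ ρ : Measure 𝔼} {R : ℝ} (hμ : ∀ᵐ x ∂μ, ‖x‖ ≤ R)
    {γ : Measure (𝔼 × 𝔼)} (hγ : γ ∈ couplings μ ρ) :
    ∫⁻ z, sqExcess R z ∂ρ ≤ ∫⁻ p, sqCost p.1 p.2 ∂γ := by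
  rw [← hγ.2, lintegral_map (measurable_sqExcess R) measurable_snd]
  refine lintegral_mono_ae ?_
  filter_upwards [ae_fst_of_mem_couplings hγ hμ] with p hp using sqExcess_le_sqCost hp

lemma otCost_smul_dirac_le {μ : Measure 𝔼} {R : ℝ} (hμ : ∀ᵐ x ∂μ, ‖x‖ ≤ R) (z : 𝔼) :
    otCost sqCost μ (μ Set.univ • Measure.dirac z) ≤
      μ Set.univ * ENNReal.ofReal ((R + ‖z‖) ^ 2) := by
  have hm : Measurable fun x : 𝔼 => (x, z) := by fun_prop
  have hmem : μ.map (fun x => (x, z)) ∈ couplings μ (μ Set.univ • Measure.dirac z) := by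
    constructor
    · rw [Measure.map_map measurable_fst hm]; exact Measure.map_id
    · rw [Measure.map_map measurable_snd hm]; exact Measure.map_const μ z
  refine (iInf₂_le _ hmem).trans ?_
  rw [lintegral_map measurable_sqCost hm, mul_comm, ← lintegral_const]
  refine lintegral_mono_ae ?_
  filter_upwards [hμ] with x hx using sqCost_le hx

lemma otCost_add_le {α β : Type*} [MeasurableSpace α] [MeasurableSpace β] (c : α → β → ℝ≥0∞)
    (μ₁ μ₂ : Measure α) (ν₁ ν₂ : Measure β) :
    otCost c (μ₁ + μ₂) (ν₁ + ν₂) ≤ otCost c μ₁ ν₁ + otCost c μ₂ ν₂ := by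
  simp only [otCost, ENNReal.iInf_add, ENNReal.add_iInf]
  refine le_iInf₂ fun γ' hγ' => le_iInf₂ fun γ hγ => ?_
  have hmem : γ + γ' ∈ couplings (μ₁ + μ₂) (ν₁ + ν₂) := by
    constructor
    · rw [Measure.map_add _ _ measurable_fst, hγ.1, hγ'.1]
    · rw [Measure.map_add _ _ measurable_snd, hγ.2, hγ'.2]
  exact (iInf₂_le _ hmem).trans (lintegral_add_measure _ _ _).le

/-- Sending the mass that goes to `ρ₂` to the single point `z` instead. -/
lemma otCost_reroute_le {μ ρ₁ ρ₂ : Measure 𝔼} [IsFiniteMeasure ρ₁] [IsFiniteMeasure ρ₂] {R : ℝ}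
    (hμ : ∀ᵐ x ∂μ, ‖x‖ ≤ R) {γ : Measure (𝔼 × 𝔼)} (hγ : γ ∈ couplings μ (ρ₁ + ρ₂)) (z : 𝔼) :
    otCost sqCost μ (ρ₁ + ρ₂ Set.univ • Measure.dirac z) + ∫⁻ y, sqExcess R y ∂ρ₂ ≤
      ∫⁻ p, sqCost p.1 p.2 ∂γ + ρ₂ Set.univ * ENNReal.ofReal ((R + ‖z‖) ^ 2) := by
  have hfin : ∀ b : Bool, IsFiniteMeasure (cond b ρ₁ ρ₂) := by
    intro b; cases b <;> simp only [cond_true, cond_false] <;> infer_instance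
  obtain ⟨γ', hsum, hsnd⟩ := exists_split_of_mem_couplings (ρ := fun b : Bool => cond b ρ₁ ρ₂)
    (γ := γ) (μ := μ) (by simpa using hγ)
  have h1 := hsnd true
  have h2 := hsnd false
  simp only [cond_true, cond_false] at h1 h2
  rw [Fintype.sum_bool] at hsum
  set γ₁ := γ' true
  set γ₂ := γ' false
  have hμ12 : μ = γ₁.map Prod.fst + γ₂.map Prod.fst := by
    rw [← Measure.map_add _ _ measurable_fst, ← hsum, hγ.1]
  have hmass : ρ₂ Set.univ = γ₂.map Prod.fst Set.univ := by
    rw [← h2, Measure.map_apply measurable_snd .univ, Measure.map_apply measurable_fst .univ,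
      Set.preimage_univ, Set.preimage_univ]
  have hle : γ₂.map Prod.fst ≤ μ := by
    rw [hμ12]; exact Measure.le_add_left le_rfl
  have hμ2 : ∀ᵐ x ∂γ₂.map Prod.fst, ‖x‖ ≤ R := ae_mono hle hμ
  have h3 : otCost sqCost μ (ρ₁ + ρ₂ Set.univ • Measure.dirac z) ≤
      ∫⁻ p, sqCost p.1 p.2 ∂γ₁ + ρ₂ Set.univ * ENNReal.ofReal ((R + ‖z‖) ^ 2) := by
    conv_lhs => rw [hμ12, hmass]
    refine (otCost_add_le _ _ _ _ _).trans (add_le_add ?_ ?_)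
    · exact iInf₂_le γ₁ ⟨rfl, h1⟩
    · rw [hmass]; exact otCost_smul_dirac_le hμ2 z
  have h4 : ∫⁻ y, sqExcess R y ∂ρ₂ ≤ ∫⁻ p, sqCost p.1 p.2 ∂γ₂ :=
    lintegral_sqExcess_le hμ2 ⟨rfl, h2⟩
  calc _ ≤ (∫⁻ p, sqCost p.1 p.2 ∂γ₁ + ρ₂ Set.univ * ENNReal.ofReal ((R + ‖z‖) ^ 2)) +
        ∫⁻ p, sqCost p.1 p.2 ∂γ₂ := add_le_add h3 h4
    _ = _ := by rw [hsum, lintegral_add_measure]; ring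

/-- The restriction of a discrete measure, completed by a point mass at one of the atoms. -/
lemma add_smul_dirac_mem_discreteMeasures {ρ₁ ρ₂ : Measure 𝔼} [IsProbabilityMeasure (ρ₁ + ρ₂)]
    {S : Finset 𝔼} {k : ℕ} (hk : S.card ≤ k) (hS : (ρ₁ + ρ₂) (S : Set 𝔼)ᶜ = 0) {A : Set 𝔼}
    (hA : ∀ᵐ z ∂ρ₁, z ∈ A) {z : 𝔼} (hz : z ∈ S) (hzA : z ∈ A) :
    ρ₁ + ρ₂ Set.univ • Measure.dirac z ∈ discreteMeasures k A := by
  classical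
  have : IsProbabilityMeasure (ρ₁ + ρ₂ Set.univ • Measure.dirac z) := ⟨by
    have := measure_univ (μ := ρ₁ + ρ₂)
    rw [Measure.add_apply] at this
    rw [Measure.add_apply, Measure.smul_apply, measure_univ (μ := Measure.dirac z), smul_eq_mul,
      mul_one, this]⟩
  -- The receiving point `z` is already in `S`, so no additional anchor is spent.
  refine mem_discreteMeasures_of_finset (S := S.filter (· ∈ A)) ⟨z, by simp [hz, hzA]⟩
    ((Finset.card_filter_le _ _).trans hk) (fun s hs => (Finset.mem_filter.1 hs).2) ?_
  rw [Measure.add_apply, Measure.smul_apply,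
    Measure.dirac_apply' _ (Finset.measurableSet _).compl]
  have h1 : ρ₁ (S : Set 𝔼)ᶜ = 0 := by
    rw [Measure.add_apply, add_eq_zero] at hS; exact hS.1
  have h2 : ρ₁ (↑(S.filter (· ∈ A)) : Set 𝔼)ᶜ = 0 := by
    refine measure_mono_null (t := (S : Set 𝔼)ᶜ ∪ {z | ¬ z ∈ A}) (fun x hx => ?_)
      (measure_union_null h1 hA)
    by_cases hxS : x ∈ S
    · right; intro hxA; exact hx (by simp [hxS, hxA])
    · left; simpa using hxS
  rw [h2]
  simp [hz, hzA]

lemma latentOT_le_of_zero (cz : 𝔼 → 𝔼 → ℝ≥0) {R : ℝ} {μ ν : Measure 𝔼} [IsProbabilityMeasure μ]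
    [IsProbabilityMeasure ν] (hμ : ∀ᵐ x ∂μ, ‖x‖ ≤ R) (hν : ∀ᵐ x ∂ν, ‖x‖ ≤ R) {kx ky : ℕ}
    (hkx : 1 ≤ kx) (hky : 1 ≤ ky) {A : Set 𝔼} (hA : (0 : 𝔼) ∈ A) :
    latentOT sqCost (fun z w => (cz z w : ℝ≥0∞)) sqCost kx ky A A μ ν ≤
      ENNReal.ofReal (2 * R ^ 2 + cz 0 0) := by
  have hd : ∀ k, 1 ≤ k → Measure.dirac (0 : 𝔼) ∈ discreteMeasures k A := fun k hk =>
    mem_discreteMeasures_of_finset (S := {0}) (by simp) (by simpa using hk) (by simpa using hA)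
      (by simp)
  refine (iInf₂_le _ (hd kx hkx)).trans ((iInf₂_le _ (hd ky hky)).trans ?_)
  have h1 : ∀ μ : Measure 𝔼, IsProbabilityMeasure μ → (∀ᵐ x ∂μ, ‖x‖ ≤ R) →
      otCost sqCost μ (Measure.dirac 0) ≤ ENNReal.ofReal (R ^ 2) := by
    intro μ _ hμ
    simpa using otCost_smul_dirac_le hμ 0
  have h2 : otCost (fun z w => (cz z w : ℝ≥0∞)) (Measure.dirac (0 : 𝔼)) (Measure.dirac 0) ≤
      cz 0 0 := by
    have hmem : Measure.dirac ((0 : 𝔼), (0 : 𝔼)) ∈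
        couplings (Measure.dirac (0 : 𝔼)) (Measure.dirac (0 : 𝔼)) :=
      ⟨Measure.map_dirac' measurable_fst _, Measure.map_dirac' measurable_snd _⟩
    exact (iInf₂_le _ hmem).trans (by rw [lintegral_dirac])
  rw [otCost_sqCost_comm _ ν]
  refine (add_le_add (add_le_add (h1 μ ‹_› hμ) h2) (h1 ν ‹_› hν)).trans (le_of_eq ?_)
  rw [← ENNReal.ofReal_coe_nnreal, ← ENNReal.ofReal_add (by positivity) (by positivity),
    ← ENNReal.ofReal_add (by positivity) (by positivity)]
  ring_nf

/-- For measures on a ball, the anchors can be confined to a larger ball whose radius depends on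
the inner cost only through one of its values: the mass of the expensive paths is sent along a
cheap path instead. -/
lemma exists_latentOT_closedBall_le (cz : 𝔼 → 𝔼 → ℝ≥0) {R : ℝ} (hR : 0 ≤ R) :
    ∃ B : ℝ, 0 ≤ B ∧ ∀ (μ ν : Measure 𝔼) [IsProbabilityMeasure μ] [IsProbabilityMeasure ν],
      (∀ᵐ x ∂μ, ‖x‖ ≤ R) → (∀ᵐ x ∂ν, ‖x‖ ≤ R) → ∀ kx ky : ℕ, 1 ≤ kx → 1 ≤ ky →
      latentOT sqCost (fun z w => (cz z w : ℝ≥0∞)) sqCost kx ky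
        (Metric.closedBall 0 B) (Metric.closedBall 0 B) μ ν ≤ sqLatentOT cz kx ky μ ν := by
  -- `M` bounds the cost of sending everything through `0`. `D` bounds the cost per unit of mass of
  -- a path through a pair with norms at most `R + √M` and inner cost at most `M`. With `B - R =
  -- √D`, any anchor outside the ball of radius `B` already costs at least `D` per unit.
  set M : ℝ := 2 * R ^ 2 + cz 0 0 with hM
  have hM0 : 0 ≤ M := by positivity
  set D : ℝ := (R + (R + √M)) ^ 2 + M + (R + (R + √M)) ^ 2 with hD
  have hD0 : 0 ≤ D := by positivity
  have hMD : √M ≤ √D := Real.sqrt_le_sqrt (by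
    have : 0 ≤ (R + (R + √M)) ^ 2 := by positivity
    linarith)
  set B : ℝ := R + √D with hB
  have hB0 : 0 ≤ B := by positivity
  refine ⟨B, hB0, fun μ ν _ _ hμ hν kx ky hkx hky => ?_⟩
  refine le_iInf₂ fun ρ hρ => le_iInf₂ fun σ hσ => ?_
  obtain ⟨hρp, S, hSk, hS⟩ := exists_finset_of_mem_discreteMeasures hρ
  obtain ⟨hσp, T, hTk, hT⟩ := exists_finset_of_mem_discreteMeasures hσ
  rw [otCost_sqCost_comm σ ν]
  conv_rhs => simp only [otCost, ENNReal.iInf_add, ENNReal.add_iInf]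
  refine le_iInf₂ fun γy hγy => le_iInf₂ fun π hπ => le_iInf₂ fun γx hγx => ?_
  rcases le_or_gt (ENNReal.ofReal M) (∫⁻ p, sqCost p.1 p.2 ∂γx + ∫⁻ p, cz p.1 p.2 ∂π +
    ∫⁻ p, sqCost p.1 p.2 ∂γy) with hle | hlt
  · exact (latentOT_le_of_zero cz hμ hν hkx hky (by simpa using hB0)).trans hle
  have hπp := isProbabilityMeasure_of_mem_couplings hπ
  have hπS : ∀ᵐ p ∂π, p.1 ∈ S ∧ p.2 ∈ T :=
    (ae_fst_of_mem_couplings hπ (p := (· ∈ S)) hS).and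
      (ae_snd_of_mem_couplings hπ (p := (· ∈ T)) hT)
  have hfst : Measurable fun p : 𝔼 × 𝔼 => sqExcess R p.1 :=
    (measurable_sqExcess R).comp measurable_fst
  have hsnd : Measurable fun p : 𝔼 × 𝔼 => sqExcess R p.2 :=
    (measurable_sqExcess R).comp measurable_snd
  have hadd : Measurable fun p : 𝔼 × 𝔼 => sqExcess R p.1 + sqExcess R p.2 := hfst.add hsnd
  -- Averaging over `π`: if every pair of atoms cost at least `M`, so would the whole plan.
  obtain ⟨z, hz, w, hw, hzw⟩ : ∃ z ∈ S, ∃ w ∈ T,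
      sqExcess R z + sqExcess R w + cz z w < ENNReal.ofReal M := by
    by_contra! hcon
    refine not_le.2 hlt ?_
    calc ENNReal.ofReal M = ∫⁻ _, ENNReal.ofReal M ∂π := by simp
      _ ≤ ∫⁻ p, (sqExcess R p.1 + sqExcess R p.2 + cz p.1 p.2) ∂π := by
          refine lintegral_mono_ae ?_
          filter_upwards [hπS] with p hp using hcon _ hp.1 _ hp.2
      _ = ∫⁻ p, sqExcess R p.1 ∂π + ∫⁻ p, sqExcess R p.2 ∂π + ∫⁻ p, cz p.1 p.2 ∂π := by
          rw [lintegral_add_left hadd, lintegral_add_left hfst]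
      _ = ∫⁻ y, sqExcess R y ∂ρ + ∫⁻ y, sqExcess R y ∂σ + ∫⁻ p, cz p.1 p.2 ∂π := by
          rw [← lintegral_map (measurable_sqExcess R) measurable_fst, hπ.1,
            ← lintegral_map (measurable_sqExcess R) measurable_snd, hπ.2]
      _ ≤ ∫⁻ p, sqCost p.1 p.2 ∂γx + ∫⁻ p, sqCost p.1 p.2 ∂γy + ∫⁻ p, cz p.1 p.2 ∂π := by
          gcongr
          · exact lintegral_sqExcess_le hμ hγx
          · exact lintegral_sqExcess_le hν hγy
      _ = _ := add_right_comm _ _ _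
  have hzM : ‖z‖ ≤ R + √M := norm_le_of_sqExcess_lt
    ((le_add_of_le_left (le_add_of_le_left le_rfl)).trans_lt hzw)
  have hwM : ‖w‖ ≤ R + √M := norm_le_of_sqExcess_lt
    ((le_add_of_le_left (le_add_of_le_right le_rfl)).trans_lt hzw)
  have hczM : (cz z w : ℝ≥0∞) ≤ ENNReal.ofReal M :=
    ((le_add_of_le_right le_rfl).trans_lt hzw).le
  -- A pair is discarded as soon as one end is far, so the same mass `m` leaves both marginals and
  -- can be sent from `z` to `w`.
  set G : Set (𝔼 × 𝔼) := {p | ‖p.1‖ ≤ B ∧ ‖p.2‖ ≤ B} with hG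
  have hGm : MeasurableSet G := by
    have h1 : MeasurableSet {p : 𝔼 × 𝔼 | ‖p.1‖ ≤ B} :=
      measurableSet_le (by fun_prop) measurable_const
    have h2 : MeasurableSet {p : 𝔼 × 𝔼 | ‖p.2‖ ≤ B} :=
      measurableSet_le (by fun_prop) measurable_const
    exact h1.inter h2
  set π₁ := π.restrict G with hπ₁
  set π₂ := π.restrict Gᶜ with hπ₂
  have hπ12 : π = π₁ + π₂ := (Measure.restrict_add_restrict_compl hGm).symm
  set ρ₁ := π₁.map Prod.fst
  set ρ₂ := π₂.map Prod.fst
  set σ₁ := π₁.map Prod.snd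
  set σ₂ := π₂.map Prod.snd
  have hρ12 : ρ = ρ₁ + ρ₂ := by rw [← Measure.map_add _ _ measurable_fst, ← hπ12, hπ.1]
  have hσ12 : σ = σ₁ + σ₂ := by rw [← Measure.map_add _ _ measurable_snd, ← hπ12, hπ.2]
  set m := π₂ Set.univ with hm
  have hρm : ρ₂ Set.univ = m := by
    rw [Measure.map_apply measurable_fst .univ, Set.preimage_univ]
  have hσm : σ₂ Set.univ = m := by
    rw [Measure.map_apply measurable_snd .univ, Set.preimage_univ]
  have hGae : ∀ᵐ p ∂π₁, p ∈ G := ae_restrict_mem hGm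
  have hρA : ∀ᵐ y ∂ρ₁, y ∈ Metric.closedBall (0 : 𝔼) B := by
    refine (ae_map_iff measurable_fst.aemeasurable measurableSet_closedBall).2 ?_
    filter_upwards [hGae] with p hp using by simpa using hp.1
  have hσA : ∀ᵐ y ∂σ₁, y ∈ Metric.closedBall (0 : 𝔼) B := by
    refine (ae_map_iff measurable_snd.aemeasurable measurableSet_closedBall).2 ?_
    filter_upwards [hGae] with p hp using by simpa using hp.2
  have hρ' : ρ₁ + m • Measure.dirac z ∈ discreteMeasures kx (Metric.closedBall (0 : 𝔼) B) := by
    rw [hρ12] at hρp hS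
    rw [← hρm]
    exact add_smul_dirac_mem_discreteMeasures hSk hS hρA hz (by simp; linarith)
  have hσ' : σ₁ + m • Measure.dirac w ∈ discreteMeasures ky (Metric.closedBall (0 : 𝔼) B) := by
    rw [hσ12] at hσp hT
    rw [← hσm]
    exact add_smul_dirac_mem_discreteMeasures hTk hT hσA hw (by simp; linarith)
  refine (iInf₂_le _ hρ').trans ((iInf₂_le _ hσ').trans ?_)
  rw [hρ12] at hγx
  rw [hσ12] at hγy
  have hx := otCost_reroute_le hμ hγx z
  have hy := otCost_reroute_le hν hγy w
  rw [hρm] at hx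
  rw [hσm] at hy
  rw [otCost_sqCost_comm _ ν]
  have hmid : otCost (fun z w => (cz z w : ℝ≥0∞)) (ρ₁ + m • Measure.dirac z)
      (σ₁ + m • Measure.dirac w) ≤ ∫⁻ p, cz p.1 p.2 ∂π₁ + m * cz z w := by
    refine (otCost_add_le _ _ _ _ _).trans (add_le_add (iInf₂_le π₁ ⟨rfl, rfl⟩) ?_)
    have hmem : m • Measure.dirac (z, w) ∈
        couplings (m • Measure.dirac z) (m • Measure.dirac w) := by
      constructor
      · rw [Measure.map_smul, Measure.map_dirac' measurable_fst]
      · rw [Measure.map_smul, Measure.map_dirac' measurable_snd]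
    refine (iInf₂_le _ hmem).trans (le_of_eq ?_)
    rw [lintegral_smul_measure, lintegral_dirac, smul_eq_mul]
  have hm_top : m ≠ ∞ := measure_ne_top _ _
  have hgain : m * ENNReal.ofReal D ≤ ∫⁻ y, sqExcess R y ∂ρ₂ + ∫⁻ y, sqExcess R y ∂σ₂ := by
    rw [lintegral_map (measurable_sqExcess R) measurable_fst,
      lintegral_map (measurable_sqExcess R) measurable_snd,
      ← lintegral_add_left hfst, mul_comm,
      ← lintegral_const]
    refine lintegral_mono_ae ?_
    filter_upwards [ae_restrict_mem hGm.compl] with p hp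
    have hBD : ENNReal.ofReal D = ENNReal.ofReal ((B - R) ^ 2) := by
      rw [hB, add_sub_cancel_left, Real.sq_sqrt hD0]
    have hRB : R ≤ B := by rw [hB]; linarith [Real.sqrt_nonneg D]
    rw [hBD]
    simp only [hG, Set.mem_compl_iff, Set.mem_ofPred_eq, not_and_or, not_le] at hp
    rcases hp with hp | hp
    · exact le_add_of_le_left (le_sqExcess hRB hp.le)
    · exact le_add_of_le_right (le_sqExcess hRB hp.le)
  have hDle : ENNReal.ofReal ((R + ‖z‖) ^ 2) + cz z w + ENNReal.ofReal ((R + ‖w‖) ^ 2) ≤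
      ENNReal.ofReal D := by
    rw [hD, ENNReal.ofReal_add (by positivity) (by positivity),
      ENNReal.ofReal_add (by positivity) (by positivity)]
    gcongr
  have hzint : ∫⁻ p, (cz p.1 p.2 : ℝ≥0∞) ∂π₁ ≤ ∫⁻ p, cz p.1 p.2 ∂π :=
    lintegral_mono' Measure.restrict_le_self le_rfl
  -- Subtraction is avoided: the gain is added on the left, the rerouting cost on the right, and the
  -- finite quantity `m * D` cancels.
  refine (ENNReal.add_le_add_iff_right (ENNReal.mul_ne_top hm_top ENNReal.ofReal_ne_top :
    m * ENNReal.ofReal D ≠ ∞)).1 ?_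
  calc _ ≤ otCost sqCost μ (ρ₁ + m • Measure.dirac z) +
        (∫⁻ p, cz p.1 p.2 ∂π + m * cz z w) + otCost sqCost ν (σ₁ + m • Measure.dirac w) +
        (∫⁻ y, sqExcess R y ∂ρ₂ + ∫⁻ y, sqExcess R y ∂σ₂) := by
        gcongr
        exact hmid.trans (by gcongr)
    _ = (otCost sqCost μ (ρ₁ + m • Measure.dirac z) + ∫⁻ y, sqExcess R y ∂ρ₂) +
        (∫⁻ p, cz p.1 p.2 ∂π + m * cz z w) +
        (otCost sqCost ν (σ₁ + m • Measure.dirac w) + ∫⁻ y, sqExcess R y ∂σ₂) := by ring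
    _ ≤ (∫⁻ p, sqCost p.1 p.2 ∂γx + m * ENNReal.ofReal ((R + ‖z‖) ^ 2)) +
        (∫⁻ p, cz p.1 p.2 ∂π + m * cz z w) +
        (∫⁻ p, sqCost p.1 p.2 ∂γy + m * ENNReal.ofReal ((R + ‖w‖) ^ 2)) := by gcongr
    _ = (∫⁻ p, sqCost p.1 p.2 ∂γx + ∫⁻ p, cz p.1 p.2 ∂π + ∫⁻ p, sqCost p.1 p.2 ∂γy) +
        m * (ENNReal.ofReal ((R + ‖z‖) ^ 2) + cz z w + ENNReal.ofReal ((R + ‖w‖) ^ 2)) := by ring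
    _ ≤ _ := by gcongr

end Confinement

/-! ### Minima of quadratics as a Lipschitz family -/

section Minima

variable {k : ℕ} [NeZero k]

/-- The minimum of the `k` quadratic functions `x ↦ t i * ‖x‖² + ⟪v i, x⟫ + b i`, where
`θ i = (t i, v i, b i)`. -/
noncomputable def quadMin (θ : Fin k → ℝ × 𝔼 × ℝ) (x : 𝔼) : ℝ :=
  Finset.univ.inf' Finset.univ_nonempty
    fun i => (θ i).1 * ‖x‖ ^ 2 + inner ℝ (θ i).2.1 x + (θ i).2.2

lemma measurable_quadMin (θ : Fin k → ℝ × 𝔼 × ℝ) : Measurable (quadMin θ) := by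
  unfold quadMin
  simp only [Finset.inf'_univ_eq_ciInf]
  exact Measurable.iInf fun i => by fun_prop

/-- The leading coefficient is left free instead of being fixed at `1` so that this holds: chaining
starts at the parameter `0`. -/
lemma quadMin_zero (x : 𝔼) : quadMin (0 : Fin k → ℝ × 𝔼 × ℝ) x = 0 := by
  simp [quadMin]

/-- Test the left minimum at an index that is optimal for `θ'`. The three coefficients multiply
quantities of size at most `R ^ 2`, `R` and `1`. -/
lemma quadMin_le_add {R : ℝ} {x : 𝔼} (hx : ‖x‖ ≤ R) (θ θ' : Fin k → ℝ × 𝔼 × ℝ) :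
    quadMin θ x ≤ quadMin θ' x + (R ^ 2 + R + 1) * ‖θ - θ'‖ := by
  obtain ⟨i, -, hi⟩ := Finset.exists_mem_eq_inf' Finset.univ_nonempty
    fun i => (θ' i).1 * ‖x‖ ^ 2 + inner ℝ (θ' i).2.1 x + (θ' i).2.2
  have h1 : quadMin θ x ≤ (θ i).1 * ‖x‖ ^ 2 + inner ℝ (θ i).2.1 x + (θ i).2.2 :=
    Finset.inf'_le _ (Finset.mem_univ i)
  have hn : ‖θ i - θ' i‖ ≤ ‖θ - θ'‖ := norm_le_pi_norm (θ - θ') i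
  have hn1 : (θ i).1 - (θ' i).1 ≤ ‖θ - θ'‖ :=
    (le_abs_self _).trans ((norm_fst_le (θ i - θ' i)).trans hn)
  have hn2 : ‖(θ i).2.1 - (θ' i).2.1‖ ≤ ‖θ - θ'‖ :=
    (norm_fst_le (θ i - θ' i).2).trans ((norm_snd_le (θ i - θ' i)).trans hn)
  have hn3 : (θ i).2.2 - (θ' i).2.2 ≤ ‖θ - θ'‖ :=
    (le_abs_self _).trans
      ((norm_snd_le (θ i - θ' i).2).trans ((norm_snd_le (θ i - θ' i)).trans hn))
  have h2 : inner ℝ (θ i).2.1 x - inner ℝ (θ' i).2.1 x ≤ ‖θ - θ'‖ * R := by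
    rw [← inner_sub_left]
    exact (real_inner_le_norm _ _).trans (by gcongr)
  have h3 : ((θ i).1 - (θ' i).1) * ‖x‖ ^ 2 ≤ ‖θ - θ'‖ * R ^ 2 := by
    calc _ ≤ ‖θ - θ'‖ * ‖x‖ ^ 2 := by gcongr
      _ ≤ _ := by gcongr
  have h4 : quadMin θ' x = (θ' i).1 * ‖x‖ ^ 2 + inner ℝ (θ' i).2.1 x + (θ' i).2.2 := hi
  linarith

lemma abs_quadMin_sub_le {R : ℝ} {x : 𝔼} (hx : ‖x‖ ≤ R) (θ θ' : Fin k → ℝ × 𝔼 × ℝ) :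
    |quadMin θ x - quadMin θ' x| ≤ (R ^ 2 + R + 1) * ‖θ - θ'‖ := by
  rw [abs_le]
  have h1 := quadMin_le_add hx θ θ'
  have h2 := quadMin_le_add hx θ' θ
  rw [norm_sub_rev] at h2
  constructor <;> linarith

/-- Expand the square. The radius adds up bounds for the three coefficients, where their maximum
would do. -/
lemma exists_quadMin_eq {R B : ℝ} (hB : 0 ≤ B) {a : Fin k → 𝔼} (ha : ∀ i, ‖a i‖ ≤ B) {φ : Fin k → ℝ}
    (hφ : ∀ i, |φ i| ≤ (R + B) ^ 2) :
    ∃ θ : Fin k → ℝ × 𝔼 × ℝ, ‖θ‖ ≤ 1 + 2 * B + B ^ 2 + (R + B) ^ 2 ∧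
      ∀ x, Finset.univ.inf' Finset.univ_nonempty (fun i => ‖x - a i‖ ^ 2 - φ i) = quadMin θ x := by
  have h2 : 0 ≤ (R + B) ^ 2 := by positivity
  refine ⟨fun i => (1, (-2 : ℝ) • a i, ‖a i‖ ^ 2 - φ i), ?_, fun x => ?_⟩
  · refine (pi_norm_le_iff_of_nonneg (by positivity)).2 fun i => ?_
    have h3 : ‖a i‖ ^ 2 ≤ B ^ 2 := by gcongr; exact ha i
    simp only [norm_prod_le_iff, norm_smul, Real.norm_eq_abs]
    refine ⟨by simp; nlinarith, ?_, ?_⟩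
    · norm_num; nlinarith [ha i]
    · refine (abs_sub _ _).trans ?_
      rw [abs_of_nonneg (by positivity)]
      linarith [hφ i]
  · unfold quadMin
    congr 1
    ext i
    rw [norm_sub_sq_real, inner_smul_left, real_inner_comm]
    simp
    ring

end Minima

/-! ### Uniform deviation of empirical means -/

section Empirical

lemma isProbabilityMeasure_empirical {α : Type*} [MeasurableSpace α] {n : ℕ} (hn : 1 ≤ n)
    (x : Fin n → α) : IsProbabilityMeasure (empirical x) := ⟨by
  rw [empirical, Measure.smul_apply, Measure.finsetSum_apply]
  simp only [measure_univ, Finset.sum_const, Finset.card_univ, Fintype.card_fin, nsmul_eq_mul,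
    mul_one, smul_eq_mul]
  exact ENNReal.inv_mul_cancel (by simp; omega) (by simp)⟩

lemma ae_empirical {α : Type*} [MeasurableSpace α] [MeasurableSingletonClass α] {n : ℕ}
    {x : Fin n → α} {p : α → Prop} (h : ∀ i, p (x i)) : ∀ᵐ z ∂empirical x, p z := by
  refine Measure.ae_smul_measure ?_ _
  rw [← Measure.sum_fintype, Measure.ae_sum_iff]
  exact fun i => by rw [ae_dirac_eq]; exact h i

lemma integral_empirical {α : Type*} [MeasurableSpace α] [MeasurableSingletonClass α] {n : ℕ}
    (x : Fin n → α) (f : α → ℝ) : ∫ z, f z ∂empirical x = (∑ i, f (x i)) / n := by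
  rw [empirical, integral_smul_measure, integral_finsetSum_measure fun i _ => ?_]
  · simp [div_eq_inv_mul]
  · exact integrable_dirac (by simp)

/-- Uniform deviation of empirical means over the functions `quadMin θ` with bounded `θ`. -/
lemma exists_measure_quadMin_deviation_le (d : ℕ) {R r : ℝ} (hR : 0 ≤ R) (hr : 0 < r) :
    ∃ C : ℝ, 0 ≤ C ∧ ∀ (k : ℕ) [NeZero k] (μ : Measure (EuclideanSpace ℝ (Fin d)))
      [IsProbabilityMeasure μ], (∀ᵐ x ∂μ, ‖x‖ ≤ R) → ∀ n : ℕ, 1 ≤ n →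
      ∀ (Ω : Type*) [MeasurableSpace Ω] (P : Measure Ω) [IsProbabilityMeasure P]
        (X : Fin n → Ω → EuclideanSpace ℝ (Fin d)), (∀ i, HasLaw (X i) μ P) → iIndepFun X P →
      ∀ δ : ℝ, 0 < δ → δ < 1 →
      P {ω | ∃ θ : Fin k → ℝ × EuclideanSpace ℝ (Fin d) × ℝ, ‖θ‖ ≤ r ∧
        C * √((k + Real.log (2 / δ)) / n) <
          |∫ x, quadMin θ x ∂empirical (fun i => X i ω) - ∫ x, quadMin θ x ∂μ|} ≤
        ENNReal.ofReal (δ / 2) := by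
  obtain ⟨A, hA, hnet⟩ := exists_dyadic_nets_pi (ℝ × EuclideanSpace ℝ (Fin d) × ℝ)
  have hlogA : 0 ≤ Real.log A := Real.log_nonneg (by exact_mod_cast hA)
  set Λ : ℝ := R ^ 2 + R + 1 with hΛ
  have hΛ0 : 0 < Λ := by positivity
  -- With `N = A ^ k` and `log (8 / δ) ≤ 3 * log (2 / δ)`, the chaining radicand is at most `(4 *
  -- log A + 6) * (k + log (2 / δ)) / n`, so `k` stays out of the constant.
  refine ⟨8 * Λ * r * √(4 * Real.log A + 6), by positivity,
    fun k _ μ _ hμ n hn Ω _ P _ X hX hind δ hδ hδ1 => ?_⟩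
  obtain ⟨S, hS0, hSc, hS⟩ := hnet k r hr.le
  have key := measure_exists_deviation_le (N := A ^ k) (Nat.one_le_pow _ _ hA) hr hΛ0 hS0
    (fun l => by rw [← pow_mul]; exact hSc l) hS hn hX hind (K := {x | ‖x‖ ≤ R}) hμ
    (f := quadMin) measurable_quadMin (fun x _ => quadMin_zero x)
    (fun θ θ' x hx => abs_quadMin_sub_le hx θ θ') hδ hδ1
  refine (measure_mono ?_).trans key
  rintro ω ⟨θ, hθ, hlt⟩
  refine ⟨θ, hθ, lt_of_le_of_lt ?_ (by rwa [integral_empirical] at hlt)⟩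
  rw [mul_assoc (8 * Λ * r), ← Real.sqrt_mul (by positivity)]
  gcongr 8 * Λ * r * √?_
  rw [← mul_div_assoc]
  refine div_le_div_of_nonneg_right ?_ (Nat.cast_nonneg n)
  have hk : (1 : ℝ) ≤ k := by exact_mod_cast NeZero.one_le
  have hlog : Real.log (8 / δ) ≤ 3 * Real.log (2 / δ) := by
    have h1 : Real.log (8 / δ) = 3 * Real.log 2 - Real.log δ := by
      rw [Real.log_div (by norm_num) hδ.ne', show (8 : ℝ) = 2 ^ 3 by norm_num, Real.log_pow]
      norm_num
    rw [h1, Real.log_div (by norm_num) hδ.ne']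
    linarith [Real.log_neg hδ hδ1]
  have hlog0 : 0 ≤ Real.log (2 / δ) := Real.log_nonneg (by rw [le_div_iff₀ hδ]; linarith)
  have h2 : Real.log ((A ^ k : ℕ) : ℝ) = k * Real.log A := by push_cast; exact Real.log_pow _ _
  rw [h2]
  nlinarith [mul_nonneg hlogA hlog0]

end Empirical

/-! ### Comparing latent costs and rates -/

section Comparison

lemma discreteMeasures_mono {α : Type*} [MeasurableSpace α] (k : ℕ) {A B : Set α} (h : A ⊆ B) :
    discreteMeasures k A ⊆ discreteMeasures k B := by
  rintro ρ ⟨w, a, hw, ha, rfl⟩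
  exact ⟨w, a, hw, fun i => h (ha i), rfl⟩

lemma sqLatentOT_le_latentOT (cz : 𝔼 → 𝔼 → ℝ≥0) (kx ky : ℕ) (A : Set 𝔼) (μ ν : Measure 𝔼) :
    sqLatentOT cz kx ky μ ν ≤
      latentOT sqCost (fun z w => (cz z w : ℝ≥0∞)) sqCost kx ky A A μ ν :=
  le_iInf₂ fun ρ hρ => le_iInf₂ fun σ hσ =>
    (iInf₂_le ρ (discreteMeasures_mono kx A.subset_univ hρ)).trans
      (iInf₂_le σ (discreteMeasures_mono ky A.subset_univ hσ))

lemma otCost_le_otCost_add_of_quadMin {k : ℕ} [NeZero k] {R B ε : ℝ} (hB : 0 ≤ B)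
    {μ μ' : Measure 𝔼}
    [IsProbabilityMeasure μ] [IsProbabilityMeasure μ'] (hμ : ∀ᵐ x ∂μ, ‖x‖ ≤ R)
    (hμ' : ∀ᵐ x ∂μ', ‖x‖ ≤ R)
    (h : ∀ θ : Fin k → ℝ × 𝔼 × ℝ, ‖θ‖ ≤ 1 + 2 * B + B ^ 2 + (R + B) ^ 2 →
      |∫ x, quadMin θ x ∂μ' - ∫ x, quadMin θ x ∂μ| ≤ ε)
    {ρ : Measure 𝔼} (hρ : ρ ∈ discreteMeasures k (Metric.closedBall (0 : 𝔼) B)) :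
    otCost sqCost μ ρ ≤ otCost sqCost μ' ρ + ENNReal.ofReal ε ∧
      otCost sqCost μ' ρ ≤ otCost sqCost μ ρ + ENNReal.ofReal ε := by
  obtain ⟨w, a, hw, ha, rfl⟩ := hρ
  have ha' : ∀ i, ‖a i‖ ≤ B := fun i => by simpa using ha i
  constructor
  · refine otCost_le_otCost_add hμ hμ' ha' hw fun φ hφ => ?_
    obtain ⟨θ, hθ, heq⟩ := exists_quadMin_eq hB ha' hφ
    simp only [heq]
    linarith [(abs_le.1 (h θ hθ)).1]
  · refine otCost_le_otCost_add hμ' hμ ha' hw fun φ hφ => ?_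
    obtain ⟨θ, hθ, heq⟩ := exists_quadMin_eq hB ha' hφ
    simp only [heq]
    linarith [(abs_le.1 (h θ hθ)).2]

lemma latentOT_le_latentOT_add {cz : 𝔼 → 𝔼 → ℝ≥0∞} {kx ky : ℕ} {A : Set 𝔼}
    {μ μ' ν ν' : Measure 𝔼} {ε₁ ε₂ : ℝ≥0∞}
    (hx : ∀ ρ ∈ discreteMeasures kx A, otCost sqCost μ ρ ≤ otCost sqCost μ' ρ + ε₁)
    (hy : ∀ σ ∈ discreteMeasures ky A, otCost sqCost ν σ ≤ otCost sqCost ν' σ + ε₂) :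
    latentOT sqCost cz sqCost kx ky A A μ ν ≤
      latentOT sqCost cz sqCost kx ky A A μ' ν' + (ε₁ + ε₂) := by
  unfold latentOT
  simp only [ENNReal.iInf_add]
  refine le_iInf₂ fun ρ hρ => le_iInf₂ fun σ hσ => ?_
  refine (iInf₂_le ρ hρ).trans ((iInf₂_le σ hσ).trans ?_)
  rw [otCost_sqCost_comm σ ν, otCost_sqCost_comm σ ν']
  calc _ ≤ (otCost sqCost μ' ρ + ε₁) + otCost cz ρ σ + (otCost sqCost ν' σ + ε₂) := by
        gcongr
        · exact hx ρ hρ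
        · exact hy σ hσ
    _ = _ := by ring

lemma abs_toReal_sub_toReal_le {a b : ℝ≥0∞} (ha : a ≠ ∞) (hb : b ≠ ∞) {ε : ℝ} (hε : 0 ≤ ε)
    (hab : a ≤ b + ENNReal.ofReal ε) (hba : b ≤ a + ENNReal.ofReal ε) :
    |a.toReal - b.toReal| ≤ ε := by
  have h : ∀ {a b : ℝ≥0∞}, b ≠ ∞ → a ≤ b + ENNReal.ofReal ε → a.toReal ≤ b.toReal + ε := by
    intro a b hb hab
    have := ENNReal.toReal_mono (ENNReal.add_ne_top.2 ⟨hb, ENNReal.ofReal_ne_top⟩) hab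
    rwa [ENNReal.toReal_add hb ENNReal.ofReal_ne_top, ENNReal.toReal_ofReal hε] at this
  rw [abs_sub_le_iff]
  constructor
  · linarith [h hb hab]
  · linarith [h ha hba]

lemma sqLatentOT_ne_top (cz : 𝔼 → 𝔼 → ℝ≥0) {R : ℝ} {μ ν : Measure 𝔼} [IsProbabilityMeasure μ]
    [IsProbabilityMeasure ν] (hμ : ∀ᵐ x ∂μ, ‖x‖ ≤ R) (hν : ∀ᵐ x ∂ν, ‖x‖ ≤ R) {kx ky : ℕ}
    (hkx : 1 ≤ kx) (hky : 1 ≤ ky) : sqLatentOT cz kx ky μ ν ≠ ∞ :=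
  ((latentOT_le_of_zero cz hμ hν hkx hky (Set.mem_univ 0)).trans_lt ENNReal.ofReal_lt_top).ne

/-- Finiteness is needed for every outcome, including those whose samples leave the compact set, so
the radius is built from the sample itself. -/
lemma sqLatentOT_empirical_ne_top (cz : 𝔼 → 𝔼 → ℝ≥0) {n m : ℕ} (hn : 1 ≤ n) (hm : 1 ≤ m)
    (x : Fin n → 𝔼) (y : Fin m → 𝔼) {kx ky : ℕ} (hkx : 1 ≤ kx) (hky : 1 ≤ ky) :
    sqLatentOT cz kx ky (empirical x) (empirical y) ≠ ∞ := by
  have := isProbabilityMeasure_empirical hn x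
  have := isProbabilityMeasure_empirical hm y
  have hx : 0 ≤ ∑ i, ‖x i‖ := Finset.sum_nonneg fun _ _ => norm_nonneg _
  have hy : 0 ≤ ∑ i, ‖y i‖ := Finset.sum_nonneg fun _ _ => norm_nonneg _
  refine sqLatentOT_ne_top cz (R := ∑ i, ‖x i‖ + ∑ i, ‖y i‖) (ae_empirical fun i => ?_)
    (ae_empirical fun i => ?_) hkx hky
  · have := Finset.single_le_sum (fun j _ => norm_nonneg (x j)) (Finset.mem_univ i)
    linarith
  · have := Finset.single_le_sum (fun j _ => norm_nonneg (y j)) (Finset.mem_univ i)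
    linarith

/-- For `K ≥ 2` the cubic term dominates `K / 2`. For `K = 1` it vanishes, and `log (2 / δ) ≥ 1 / 2`
takes over. This gives the factor `3 = 2 + 1`. -/
lemma sqrt_add_log_div_le {d k K n N : ℕ} (hd : 1 ≤ d) (hk : k ≤ K) (hK : 1 ≤ K) (hN : 1 ≤ N)
    (hNn : N ≤ n) {δ : ℝ} (hδ : 0 < δ) (hδ1 : δ < 1) :
    √((k + Real.log (2 / δ)) / n) ≤
      √3 * √(((K : ℝ) ^ 3 * d * Real.log K + Real.log (2 / δ)) / N) := by
  rw [← Real.sqrt_mul (by norm_num)]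
  apply Real.sqrt_le_sqrt
  have hN0 : (0 : ℝ) < N := by exact_mod_cast hN
  have hNn' : (N : ℝ) ≤ n := by exact_mod_cast hNn
  have hlog2 : (1 / 2 : ℝ) ≤ Real.log 2 := by linarith [Real.log_two_gt_d9]
  have hlog : 1 / 2 ≤ Real.log (2 / δ) := hlog2.trans
    (Real.log_le_log two_pos (by rw [le_div_iff₀ hδ]; linarith))
  have hd' : (1 : ℝ) ≤ d := by exact_mod_cast hd
  have hkK : (k : ℝ) ≤ K := by exact_mod_cast hk
  have hK1 : (1 : ℝ) ≤ K := by exact_mod_cast hK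
  have hlogK : 0 ≤ Real.log K := Real.log_nonneg hK1
  have hmain : (K : ℝ) ≤ 2 * ((K : ℝ) ^ 3 * d * Real.log K + Real.log (2 / δ)) := by
    rcases hK.eq_or_lt with h | h
    · rw [← h]; norm_num; linarith
    · have h2 : (2 : ℝ) ≤ K := by exact_mod_cast h
      have h3 : 1 / 2 ≤ Real.log K := hlog2.trans (Real.log_le_log two_pos h2)
      have h4 : (K : ℝ) ≤ (K : ℝ) ^ 3 := by
        calc (K : ℝ) = (K : ℝ) ^ 1 := (pow_one _).symm
          _ ≤ _ := pow_le_pow_right₀ hK1 (by norm_num)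
      have h5 : (K : ℝ) * 1 * (1 / 2) ≤ (K : ℝ) ^ 3 * d * Real.log K := by gcongr
      linarith
  rw [← mul_div_assoc]
  have hpos : 0 ≤ (K : ℝ) ^ 3 * d * Real.log K := by positivity
  gcongr
  linarith

end Comparison

end LatentOT

/-! ### The sample complexity bound -/

theorem proposition3 (d : ℕ) (K : Set (EuclideanSpace ℝ (Fin d))) (hK : IsCompact K)
    (cz : EuclideanSpace ℝ (Fin d) → EuclideanSpace ℝ (Fin d) → ℝ≥0) :
    ∃ C : ℝ, 0 ≤ C ∧
      ∀ (μ ν : Measure (EuclideanSpace ℝ (Fin d)))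
        [IsProbabilityMeasure μ] [IsProbabilityMeasure ν],
        μ Kᶜ = 0 → ν Kᶜ = 0 →
      ∀ kx ky n m : ℕ, 1 ≤ kx → 1 ≤ ky → 1 ≤ n → 1 ≤ m →
      ∀ (Ω : Type*) [MeasurableSpace Ω] (P : Measure Ω) [IsProbabilityMeasure P]
        (X : Fin n → Ω → EuclideanSpace ℝ (Fin d))
        (Y : Fin m → Ω → EuclideanSpace ℝ (Fin d)),
        (∀ i, HasLaw (X i) μ P) → iIndepFun X P →
        (∀ j, HasLaw (Y j) ν P) → iIndepFun Y P →
      ∀ δ : ℝ, 0 < δ → δ < 1 →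
        LatentOT.sqLatentOT cz kx ky μ ν ≠ ∞ ∧
        (∀ ω, LatentOT.sqLatentOT cz kx ky (LatentOT.empirical fun i => X i ω)
          (LatentOT.empirical fun j => Y j ω) ≠ ∞) ∧
        P {ω | ¬ |(LatentOT.sqLatentOT cz kx ky μ ν).toReal -
              (LatentOT.sqLatentOT cz kx ky (LatentOT.empirical fun i => X i ω)
                (LatentOT.empirical fun j => Y j ω)).toReal| ≤
            C * √(((max kx ky : ℕ) ^ 3 * d * Real.log (max kx ky : ℕ) + Real.log (2 / δ)) /
              (min n m : ℕ))} ≤ ENNReal.ofReal δ := by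
  obtain ⟨R, hR0, hKR⟩ := hK.isBounded.exists_pos_norm_le
  obtain ⟨B, hB0, hB⟩ := LatentOT.exists_latentOT_closedBall_le cz hR0.le
  obtain ⟨C, hC0, hC⟩ := LatentOT.exists_measure_quadMin_deviation_le d hR0.le
    (r := 1 + 2 * B + B ^ 2 + (R + B) ^ 2) (by positivity)
  refine ⟨2 * (C * √3), by positivity, fun μ ν _ _ hμK hνK kx ky n m hkx hky hn hm Ω _ P _ X Y hX
    hXi hY hYi δ hδ hδ1 => ?_⟩
  have hμ : ∀ᵐ x ∂μ, ‖x‖ ≤ R := by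
    filter_upwards [show ∀ᵐ x ∂μ, x ∈ K from hμK] with x hx using hKR x hx
  have hν : ∀ᵐ x ∂ν, ‖x‖ ≤ R := by
    filter_upwards [show ∀ᵐ x ∂ν, x ∈ K from hνK] with x hx using hKR x hx
  have hfin := LatentOT.sqLatentOT_ne_top cz hμ hν hkx hky
  have hfin' : ∀ ω, LatentOT.sqLatentOT cz kx ky (LatentOT.empirical fun i => X i ω)
      (LatentOT.empirical fun j => Y j ω) ≠ ∞ := fun ω =>
    LatentOT.sqLatentOT_empirical_ne_top cz hn hm _ _ hkx hky
  refine ⟨hfin, hfin', ?_⟩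
  have hpX : ∀ ω, IsProbabilityMeasure (LatentOT.empirical fun i => X i ω) := fun ω =>
    LatentOT.isProbabilityMeasure_empirical hn _
  have hpY : ∀ ω, IsProbabilityMeasure (LatentOT.empirical fun j => Y j ω) := fun ω =>
    LatentOT.isProbabilityMeasure_empirical hm _
  -- For `d = 0` the factor `d` removes the term that dominates `k`, but the space is a single point
  -- and all probability measures coincide.
  rcases Nat.eq_zero_or_pos d with rfl | hd
  · have hsub : ∀ (μ ν : Measure (EuclideanSpace ℝ (Fin 0))) [IsProbabilityMeasure μ]
        [IsProbabilityMeasure ν], μ = ν := by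
      intro μ ν _ _
      ext s
      refine Subsingleton.set_cases (p := fun s => μ s = ν s) (by simp) (by simp) s
    refine le_of_eq_of_le (measure_mono_null (t := ∅) (fun ω hω => hω ?_) measure_empty) zero_le
    rw [← hsub μ (LatentOT.empirical fun i => X i ω), ← hsub ν (LatentOT.empirical fun j => Y j ω),
      sub_self, abs_zero]
    positivity
  have : NeZero kx := ⟨by omega⟩
  have : NeZero ky := ⟨by omega⟩
  have hdevX := hC kx μ hμ n hn Ω P X hX hXi δ hδ hδ1
  have hdevY := hC ky ν hν m hm Ω P Y hY hYi δ hδ hδ1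
  have hXR : ∀ᵐ ω ∂P, ∀ i, ‖X i ω‖ ≤ R := ae_all_iff.2 fun i =>
    ae_of_ae_map (hX i).aemeasurable ((hX i).map_eq.symm ▸ hμ)
  have hYR : ∀ᵐ ω ∂P, ∀ j, ‖Y j ω‖ ≤ R := ae_all_iff.2 fun j =>
    ae_of_ae_map (hY j).aemeasurable ((hY j).map_eq.symm ▸ hν)
  have hsplit : ENNReal.ofReal δ = ENNReal.ofReal (δ / 2) + ENNReal.ofReal (δ / 2) := by
    rw [← ENNReal.ofReal_add (by positivity) (by positivity), add_halves]
  rw [hsplit]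
  refine le_trans ?_ ((measure_union_le _ _).trans (add_le_add hdevX hdevY))
  refine measure_mono_ae ?_
  filter_upwards [hXR, hYR] with ω hXω hYω hω
  by_contra hgood
  refine hω ?_
  change ¬ ((∃ θ, _) ∨ ∃ θ, _) at hgood
  simp only [not_or, not_exists, not_and, not_lt] at hgood
  obtain ⟨hgX, hgY⟩ := hgood
  set ε : ℝ := C * √3 * √(((max kx ky : ℕ) ^ 3 * d * Real.log (max kx ky : ℕ) +
    Real.log (2 / δ)) / (min n m : ℕ)) with hε
  have hε0 : 0 ≤ ε := by positivity
  have hεX : C * √((kx + Real.log (2 / δ)) / n) ≤ ε := by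
    rw [hε, mul_assoc]
    exact mul_le_mul_of_nonneg_left (LatentOT.sqrt_add_log_div_le hd (le_max_left _ _)
      (hkx.trans (le_max_left _ _)) (le_min hn hm) (min_le_left _ _) hδ hδ1) hC0
  have hεY : C * √((ky + Real.log (2 / δ)) / m) ≤ ε := by
    rw [hε, mul_assoc]
    exact mul_le_mul_of_nonneg_left (LatentOT.sqrt_add_log_div_le hd (le_max_right _ _)
      (hkx.trans (le_max_left _ _)) (le_min hn hm) (min_le_right _ _) hδ hδ1) hC0
  have hμ' : ∀ᵐ x ∂LatentOT.empirical fun i => X i ω, ‖x‖ ≤ R := LatentOT.ae_empirical hXω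
  have hν' : ∀ᵐ x ∂LatentOT.empirical fun j => Y j ω, ‖x‖ ≤ R := LatentOT.ae_empirical hYω
  have hx := fun ρ hρ => LatentOT.otCost_le_otCost_add_of_quadMin (k := kx) hB0 hμ hμ'
    (fun θ hθ => (hgX θ hθ).trans hεX) (ρ := ρ) hρ
  have hy := fun σ hσ => LatentOT.otCost_le_otCost_add_of_quadMin (k := ky) hB0 hν hν'
    (fun θ hθ => (hgY θ hθ).trans hεY) (ρ := σ) hσ
  have hεε : ENNReal.ofReal (2 * ε) = ENNReal.ofReal ε + ENNReal.ofReal ε := by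
    rw [← ENNReal.ofReal_add hε0 hε0, two_mul]
  refine (LatentOT.abs_toReal_sub_toReal_le hfin (hfin' ω) (ε := 2 * ε) (by positivity)
    ?_ ?_).trans (le_of_eq (by rw [hε]; ring))
  -- Confining anchors only raises the cost on the left; the confined costs differ by at most `ε`
  -- per outer leg; on the right, confinement costs nothing by `hB`.
  · rw [hεε]
    refine (LatentOT.sqLatentOT_le_latentOT cz kx ky (Metric.closedBall 0 B) _ _).trans ?_
    refine (LatentOT.latentOT_le_latentOT_add (fun ρ hρ => (hx ρ hρ).1)
      (fun σ hσ => (hy σ hσ).1)).trans ?_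
    gcongr
    exact hB _ _ hμ' hν' kx ky hkx hky
  · rw [hεε]
    refine (LatentOT.sqLatentOT_le_latentOT cz kx ky (Metric.closedBall 0 B) _ _).trans ?_
    refine (LatentOT.latentOT_le_latentOT_add (fun ρ hρ => (hx ρ hρ).2)
      (fun σ hσ => (hy σ hσ).2)).trans ?_
    gcongr
    exact hB _ _ hμ hν kx ky hkx hky
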